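/- Let $(z_t)_{t\in[0,1]}$ be random vectors in $\mathbb{R}^k$ and let $y$ be a random observation with values in a measurable space, all defined on one probability space, with $z_t\to z_0$ almost surely as $t\downarrow 0$. For each $t\in(0,1]$ let $p_t(\cdot\mid y)$ be a conditional Lebesgue density of $z_t$ given $y$, and let $p(z_0\mid y)$ denote the posterior, i.e. the regular conditional distribution of $z_0$ given $y$. Let $v_t(\cdot\mid y)$, $t\in(0,1]$, be conditional velocity fields on $\mathbb{R}^k$. Then the following holds for almost every value of $y$ (with respect to its law) for which conditions 1–4 hold. 1. For every $t\in(0,1]$, $p_t(\cdot\mid y)$ is a probability density (nonnegative, with integral $1$). The function $(t,z)\mapsto p_t(z\mid y)$ is continuous on $(0,1]\times\mathbb{R}^k$ and continuously differentiable on $(0,1)\times\mathbb{R}^k$. 2. The field $(t,z)\mapsto v_t(z\mid y)$ is continuous on $(0,1]\times\mathbb{R}^k$, is differentiable in $z$, and its derivative in $z$ is continuous on $(0,1]\times\mathbb{R}^k$. 3. The reverse-time continuity equation holds: $$\partial_t p_t(z\mid y)=\nabla_z\cdot\big[p_t(z\mid y)\,v_t(z\mid y)\big],\qquad t\in(0,1),\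 z\in\mathbb{R}^k.$$ 4. $p_1(\cdot\mid y)$ is the density of $\mathcal N(0,I)$. (a) Let $(x_t)_{t\in(0,1]}$ be any random curve, on any probability space, with $x_1\sim\mathcal N(0,I)$ whose paths almost surely solve the reverse-time ODE $$\frac{dx_t}{dt}=-v_t(x_t\mid y),\qquad t\in(0,1],$$ (the derivative being one-sided at $t=1$). Then $x_t$ has density $p_t(\cdot\mid y)$ for every $t\in(0,1]$, and $x_t$ converges in distribution to the posterior $p(z_0\mid y)$ as $t\downarrow0$. If moreover $x_t$ converges almost surely to some $x_0$ as $t\downarrow 0$, then $x_0\sim p(z_0\mid y)$. (b) If in addition $\int_0^1\!\int_{\mathbb{R}^k}\|v_t(z\mid y)\|\,p_t(z\mid y)\,dz\,dt<\infty$, then such a solution exists. That is, for $\mathcal N(0,I)$-almost every starting point $x_1$ the ODE has a solution $(x_t)$ on all of $(0,1]$ with value $x_1$ at $t=1$; these solutions can be chosen so that each $x_t$ is a measurable function of $x_1$, up to $\mathcal N(0,I)$-null sets; the limit $x_0=\lim_{t\downarrow0}x_t$ exists for almost every $x_1$; and if $x_1\sim\mathcal N(0,I)$, then $x_0\sim p(z_0\mid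 y)$. -/

import Mathlib

open MeasureTheory ProbabilityTheory Set Filter Topology
open scoped BoundedContinuousFunction ENNReal

universe u

/-- The divergence `∑ i, ∂ F_i / ∂ z_i` of a vector field on `ℝ^k`. -/
noncomputable def divergence {k : ℕ}
    (F : EuclideanSpace ℝ (Fin k) → EuclideanSpace ℝ (Fin k)) (z : EuclideanSpace ℝ (Fin k)) : ℝ :=
  ∑ i, fderiv ℝ F z (EuclideanSpace.single i 1) i

/-- `p` is a conditional Lebesgue density of `X` given `Y`: for almost every value `y`, the regular
conditional distribution of `X` given `Y = y` has density `p y`. -/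
def IsConditionalDensity {k : ℕ} {Ω 𝒴 : Type*} [MeasurableSpace Ω] [MeasurableSpace 𝒴]
    (P : Measure Ω) [IsFiniteMeasure P] (X : Ω → EuclideanSpace ℝ (Fin k)) (Y : Ω → 𝒴)
    (p : 𝒴 → EuclideanSpace ℝ (Fin k) → ℝ) : Prop :=
  ∀ᵐ y ∂(P.map Y), condDistrib X Y P y = volume.withDensity (fun z => ENNReal.ofReal (p y z))

/-- A path `ρ` of probability densities and a velocity field `w` on `(0, 1] × ℝ^k` with the
smoothness under which the continuity equation and the ODE are read classically. Nothing is
required at `t = 0`, where `w` may be singular and `ρ` need not have a limit density. -/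
structure IsClassicalDensityPath {k : ℕ} (ρ : ℝ → EuclideanSpace ℝ (Fin k) → ℝ)
    (w : ℝ → EuclideanSpace ℝ (Fin k) → EuclideanSpace ℝ (Fin k)) : Prop where
  nonneg : ∀ t ∈ Ioc (0 : ℝ) 1, ∀ z, 0 ≤ ρ t z
  lintegral_eq_one : ∀ t ∈ Ioc (0 : ℝ) 1, ∫⁻ z, ENNReal.ofReal (ρ t z) = 1
  density_continuousOn : ContinuousOn
    (fun q : ℝ × EuclideanSpace ℝ (Fin k) => ρ q.1 q.2) (Ioc 0 1 ×ˢ univ)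
  density_contDiffOn : ContDiffOn ℝ 1
    (fun q : ℝ × EuclideanSpace ℝ (Fin k) => ρ q.1 q.2) (Ioo 0 1 ×ˢ univ)
  velocity_continuousOn : ContinuousOn
    (fun q : ℝ × EuclideanSpace ℝ (Fin k) => w q.1 q.2) (Ioc 0 1 ×ˢ univ)
  velocity_differentiable : ∀ t ∈ Ioc (0 : ℝ) 1, Differentiable ℝ (w t)
  velocity_fderiv_continuousOn : ContinuousOn
    (fun q : ℝ × EuclideanSpace ℝ (Fin k) => fderiv ℝ (w q.1) q.2) (Ioc 0 1 ×ˢ univ)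

/-- The reverse-time continuity equation `∂_t ρ_t = ∇ · (ρ_t w_t)` on `(0, 1) × ℝ^k`. -/
def ReverseContinuityEquation {k : ℕ} (ρ : ℝ → EuclideanSpace ℝ (Fin k) → ℝ)
    (w : ℝ → EuclideanSpace ℝ (Fin k) → EuclideanSpace ℝ (Fin k)) : Prop :=
  ∀ t ∈ Ioo (0 : ℝ) 1, ∀ z,
    HasDerivAt (fun s => ρ s z) (divergence (fun x => ρ t x • w t x) z) t

/-- The random curve `X` solves `dX_t = - w_t(X_t) dt` on `(0, 1]` with `X_1 ∼ N(0, I)`. -/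
structure IsReverseODESolution {k : ℕ} {Ω : Type*} [MeasurableSpace Ω]
    (w : ℝ → EuclideanSpace ℝ (Fin k) → EuclideanSpace ℝ (Fin k)) (P : Measure Ω)
    (X : ℝ → Ω → EuclideanSpace ℝ (Fin k)) : Prop where
  aemeasurable : ∀ t ∈ Ioc (0 : ℝ) 1, AEMeasurable (X t) P
  terminal : P.map (X 1) = stdGaussian (EuclideanSpace ℝ (Fin k))
  ode : ∀ᵐ ω ∂P, ∀ t ∈ Ioc (0 : ℝ) 1,
    HasDerivWithinAt (fun s => X s ω) (-(w t (X t ω))) (Ioc 0 1) t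

/-! The core is a one-sided comparison, `map_flow_restrict_le`. Let mass distributed as `ρ 1` follow
the ODE down from time `1`, and keep only the trajectories that stay in a ball until time `s`; the
law of what is left at time `s` is at most `ρ s`. To see this, test with a function `u` that is
carried along the trajectories and killed at the boundary of the ball. If nothing were killed, the
continuity equation and an integration by parts would make `∫ u_t ρ_t` constant; killing leaves an
inequality in the useful direction (`integral_mul_density_le`). Everything has compact support, so
no growth condition on the velocity and no boundary term at infinity enters.

For (a), each given path is bounded on `[t, 1]`, so it is kept once the ball is large. Hence the law
of `X t` is at most `ρ t`, and two probability measures, one below the other, coincide.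

For (b), the same comparison bounds the mean length of the stopped trajectories by `∫∫ ‖v‖ p`.
Markov's inequality then excludes blow-up at positive times, and Fatou's lemma makes the total
length almost surely finite, which gives the limit at `0`.

For the posterior, the almost sure convergence of `Z t` passes to the conditional laws for almost
every `y`, but only along countably many times, since the exceptional null set depends on the time.
Rational times suffice because the mean of a bounded continuous function of `X t` is continuous in
`t`. -/

/-! ### Conditional laws along rational times -/

theorem tendsto_nhdsGT_zero_of_tendsto_rat {g : ℝ → ℝ} {L : ℝ} (hg : ContinuousOn g (Ioc 0 1))
    (h : Tendsto (fun q : ℚ => g q) (comap (fun q : ℚ => (q : ℝ)) (𝓝[>] 0)) (𝓝 L)) :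
    Tendsto g (𝓝[>] 0) (𝓝 L) := by
  rw [Metric.tendsto_nhds] at h ⊢
  intro ε hε
  have h1 := h (ε / 2) (half_pos hε)
  rw [eventually_comap] at h1
  obtain ⟨c, hc, hcs⟩ := mem_nhdsGT_iff_exists_Ioo_subset.1 h1
  have hc0 : (0 : ℝ) < c := hc
  filter_upwards [Ioo_mem_nhdsGT (lt_min hc0 one_pos)] with t ht
  have ht1 : t < c := ht.2.trans_le (min_le_left _ _)
  have ht2 : t < 1 := ht.2.trans_le (min_le_right _ _)
  have hcont : ContinuousAt g t := hg.continuousAt (Ioc_mem_nhds ht.1 ht2)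
  obtain ⟨δ, hδ, hd⟩ := Metric.continuousAt_iff.1 hcont (ε / 2) (half_pos hε)
  obtain ⟨q, hq1, hq2⟩ := exists_rat_btwn (lt_min ht1 (lt_add_of_pos_right t hδ))
  have hqc : (q : ℝ) < c := hq2.trans_le (min_le_left _ _)
  have hqd : (q : ℝ) < t + δ := hq2.trans_le (min_le_right _ _)
  have h2 : dist (g q) L < ε / 2 := hcs ⟨ht.1.trans hq1, hqc⟩ q rfl
  have h3 : dist (g q) (g t) < ε / 2 :=
    hd (by rw [Real.dist_eq, abs_of_pos (by linarith)]; linarith)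
  linarith [dist_triangle_left (g t) L (g q)]

/-- Conditioning the whole rational-time path at once gives a single exceptional null set. Almost
sure convergence survives in the conditional path law, and dominated convergence there gives the
limit for all test functions simultaneously. -/
theorem ae_tendsto_integral_condDistrib_rat {E Ω 𝒴 : Type*} [MeasurableSpace Ω]
    [MeasurableSpace 𝒴] [MeasurableSpace E] [TopologicalSpace E] [PolishSpace E] [BorelSpace E]
    [Nonempty E] (P : Measure Ω) [IsProbabilityMeasure P] (Z : ℝ → Ω → E) (Y : Ω → 𝒴)
    (hZ : ∀ t ∈ Icc (0 : ℝ) 1, Measurable (Z t)) (hY : Measurable Y)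
    (hZ0 : ∀ᵐ ω ∂P, Tendsto (fun t => Z t ω) (𝓝[>] 0) (𝓝 (Z 0 ω))) :
    ∀ᵐ y ∂(P.map Y), ∀ φ : E →ᵇ ℝ,
      Tendsto (fun q : ℚ => ∫ z, φ z ∂(condDistrib (Z q) Y P y))
        (comap (fun q : ℚ => (q : ℝ)) (𝓝[>] 0)) (𝓝 (∫ z, φ z ∂(condDistrib (Z 0) Y P y))) := by
  classical
  set l : Filter ℚ := comap (fun q : ℚ => (q : ℝ)) (𝓝[>] 0) with hl
  -- Outside `[0, 1]` nothing is known about `Z`, so the path is filled with `Z 0`; near `0` from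
  -- the right this changes nothing.
  let W : Ω → ℚ → E := fun ω q => if (q : ℝ) ∈ Icc (0 : ℝ) 1 then Z q ω else Z 0 ω
  have hW : Measurable W := by
    refine measurable_pi_lambda _ fun q => ?_
    by_cases hq : (q : ℝ) ∈ Icc (0 : ℝ) 1
    · simpa only [W, if_pos hq] using hZ q hq
    · simpa only [W, if_neg hq] using hZ 0 (by simp)
  have hlim : ∀ᵐ ω ∂P, Tendsto (fun q => W ω q) l (𝓝 (W ω 0)) := by
    filter_upwards [hZ0] with ω hω
    have h0 : W ω 0 = Z 0 ω := by simp [W]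
    rw [h0]
    refine (hω.comp tendsto_comap).congr' ?_
    have : ∀ᶠ t : ℝ in 𝓝[>] 0, t ∈ Icc (0 : ℝ) 1 := by
      filter_upwards [Ioo_mem_nhdsGT (zero_lt_one (α := ℝ))] with t ht using Ioo_subset_Icc_self ht
    filter_upwards [tendsto_comap.eventually this] with q hq
    simp only [W, if_pos hq, Function.comp]
  have hmeas : MeasurableSet {z : ℚ → E | Tendsto z l (𝓝 (z 0))} :=
    measurableSet_tendsto_fun (fun q => measurable_pi_apply q) (measurable_pi_apply 0)
  -- Disintegrate the joint law of observation and path: an almost sure event is almost sure under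
  -- almost every conditional law.
  have hκ : ∀ᵐ y ∂(P.map Y), ∀ᵐ z ∂(condDistrib W Y P y), Tendsto z l (𝓝 (z 0)) := by
    have h1 : ∀ᵐ x ∂(P.map fun ω => (Y ω, W ω)), Tendsto x.2 l (𝓝 (x.2 0)) := by
      exact (ae_map_iff (hY.prodMk hW).aemeasurable (measurable_snd hmeas)).2 hlim
    rw [← compProd_map_condDistrib hW.aemeasurable] at h1
    exact Measure.ae_ae_of_ae_compProd h1
  have hmarg : ∀ᵐ y ∂(P.map Y), ∀ q : ℚ, (q : ℝ) ∈ Icc (0 : ℝ) 1 →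
      condDistrib (Z q) Y P y = (condDistrib W Y P y).map (fun z => z q) := by
    rw [ae_all_iff]
    intro q
    by_cases hq : (q : ℝ) ∈ Icc (0 : ℝ) 1
    · filter_upwards [condDistrib_comp (μ := P) Y hW.aemeasurable (measurable_pi_apply q)]
        with y hy _
      rw [← Kernel.map_apply _ (measurable_pi_apply q), ← hy]
      congr 2
      funext ω
      simp only [W, Function.comp, if_pos hq]
    · exact Eventually.of_forall fun y h => absurd h hq
  filter_upwards [hκ, hmarg] with y h1 h2 φ
  have h3 : ∀ q : ℚ, (q : ℝ) ∈ Icc (0 : ℝ) 1 → ∫ z, φ z ∂(condDistrib (Z q) Y P y)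
      = ∫ z, φ (z q) ∂(condDistrib W Y P y) := by
    intro q hq
    rw [h2 q hq, integral_map (measurable_pi_apply q).aemeasurable
      φ.continuous.aestronglyMeasurable]
  have h0 := h3 0 (by simp)
  rw [Rat.cast_zero] at h0
  rw [h0]
  have h4 : Tendsto (fun q : ℚ => ∫ z, φ (z q) ∂(condDistrib W Y P y)) l
      (𝓝 (∫ z, φ (z 0) ∂(condDistrib W Y P y))) := by
    refine tendsto_integral_filter_of_dominated_convergence (fun _ => ‖φ‖) ?_ ?_
      (integrable_const _) ?_
    · exact Eventually.of_forall fun q =>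
        (φ.continuous.measurable.comp (measurable_pi_apply q)).aestronglyMeasurable
    · exact Eventually.of_forall fun q => ae_of_all _ fun z => φ.norm_coe_le_norm _
    · filter_upwards [h1] with z hz using (φ.continuous.tendsto _).comp hz
  refine h4.congr' ?_
  have : ∀ᶠ t : ℝ in 𝓝[>] 0, t ∈ Icc (0 : ℝ) 1 := by
    filter_upwards [Ioo_mem_nhdsGT (zero_lt_one (α := ℝ))] with t ht using Ioo_subset_Icc_self ht
  filter_upwards [tendsto_comap.eventually this] with q hq using (h3 q hq).symm

/-! ### Flows of bounded Lipschitz fields on a compact time interval -/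

section Flow

open scoped NNReal

variable {E : Type*} [NormedAddCommGroup E] [NormedSpace ℝ E]

theorem dist_le_of_hasDerivWithinAt_Icc_of_le {F : ℝ → E → E} {K : ℝ≥0} {a b : ℝ} {X Y : ℝ → E}
    (hF : ∀ t, LipschitzWith K (F t))
    (hX : ∀ r ∈ Icc a b, HasDerivWithinAt X (F r (X r)) (Icc a b) r)
    (hY : ∀ r ∈ Icc a b, HasDerivWithinAt Y (F r (Y r)) (Icc a b) r)
    {t r : ℝ} (ht : t ∈ Icc a b) (hr : r ∈ Icc a b) (htr : t ≤ r) :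
    dist (X r) (Y r) ≤ dist (X t) (Y t) * Real.exp (K * (b - a)) := by
  have key : ∀ {V : ℝ → E}, (∀ r ∈ Icc a b, HasDerivWithinAt V (F r (V r)) (Icc a b) r) →
      ContinuousOn V (Icc t b) ∧ ∀ x ∈ Ico t b, HasDerivWithinAt V (F x (V x)) (Ici x) x := by
    intro V hV
    refine ⟨fun x hx => ((hV x ⟨ht.1.trans hx.1, hx.2⟩).continuousWithinAt).mono
      (Icc_subset_Icc_left ht.1), fun x hx => ?_⟩
    have hxa : a ≤ x := ht.1.trans hx.1
    exact (hV x ⟨hxa, hx.2.le⟩).mono_of_mem_nhdsWithin (Icc_mem_nhdsGE_of_mem ⟨hxa, hx.2⟩)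
  have h := dist_le_of_trajectories_ODE hF (key hX).1 (key hX).2 (key hY).1 (key hY).2 le_rfl r
    ⟨htr, hr.2⟩
  refine h.trans ?_
  gcongr
  · exact hr.2
  · exact ht.1

theorem hasDerivWithinAt_comp_neg_Icc {F : ℝ → E → E} {a b : ℝ} {V : ℝ → E}
    (hV : ∀ r ∈ Icc a b, HasDerivWithinAt V (F r (V r)) (Icc a b) r) :
    ∀ r ∈ Icc (-b) (-a),
      HasDerivWithinAt (fun x => V (-x)) (-(F (-r) (V (-r)))) (Icc (-b) (-a)) r := by
  intro r hr
  have hr' : -r ∈ Icc a b := ⟨by linarith [hr.2], by linarith [hr.1]⟩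
  have h := (hV (-r) hr').scomp r (hasDerivAt_neg r).hasDerivWithinAt
    (s := Icc (-b) (-a)) (fun x hx => ⟨by linarith [hx.2], by linarith [hx.1]⟩)
  simpa [Function.comp_def] using h

theorem dist_le_of_hasDerivWithinAt_Icc {F : ℝ → E → E} {K : ℝ≥0} {a b : ℝ} {X Y : ℝ → E}
    (hF : ∀ t, LipschitzWith K (F t))
    (hX : ∀ r ∈ Icc a b, HasDerivWithinAt X (F r (X r)) (Icc a b) r)
    (hY : ∀ r ∈ Icc a b, HasDerivWithinAt Y (F r (Y r)) (Icc a b) r)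
    {t r : ℝ} (ht : t ∈ Icc a b) (hr : r ∈ Icc a b) :
    dist (X r) (Y r) ≤ dist (X t) (Y t) * Real.exp (K * (b - a)) := by
  rcases le_total t r with htr | htr
  · exact dist_le_of_hasDerivWithinAt_Icc_of_le hF hX hY ht hr htr
  -- Grönwall's estimate runs forward in time; reversing time negates the field and keeps its
  -- Lipschitz constant.
  · have h := dist_le_of_hasDerivWithinAt_Icc_of_le (F := fun s z => -(F (-s) z)) (K := K)
      (fun s => (hF (-s)).neg) (hasDerivWithinAt_comp_neg_Icc hX) (hasDerivWithinAt_comp_neg_Icc hY)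
      (t := -t) (r := -r) ⟨by linarith [ht.2], by linarith [ht.1]⟩
      ⟨by linarith [hr.2], by linarith [hr.1]⟩ (by linarith)
    simpa [neg_add_eq_sub] using h

/-- `Γ t y r` is the value at time `r ∈ [a, b]` of the solution of `x' = F(·, x)` that passes
through `y` at time `t ∈ [a, b]`; the field is bounded by `M` and the flow is `C`-Lipschitz in
`y`. -/
structure IsFlow (F : ℝ → E → E) (a b M : ℝ) (C : ℝ≥0) (Γ : ℝ → E → ℝ → E) : Prop where
  continuous_field : Continuous fun q : ℝ × E => F q.1 q.2
  norm_field_le : ∀ t y, ‖F t y‖ ≤ M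
  continuous : Continuous fun q : ℝ × E × ℝ => Γ q.1 q.2.1 q.2.2
  initial : ∀ t ∈ Icc a b, ∀ y, Γ t y t = y
  hasDerivWithinAt : ∀ t ∈ Icc a b, ∀ y, ∀ r ∈ Icc a b,
    HasDerivWithinAt (Γ t y) (F r (Γ t y r)) (Icc a b) r
  lipschitz : ∀ t ∈ Icc a b, ∀ r ∈ Icc a b, LipschitzWith C fun y => Γ t y r
  eq_of_hasDerivWithinAt : ∀ X : ℝ → E,
    (∀ r ∈ Icc a b, HasDerivWithinAt X (F r (X r)) (Icc a b) r) →
      ∀ t ∈ Icc a b, ∀ r ∈ Icc a b, Γ t (X t) r = X r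

theorem norm_sub_le_of_hasDerivWithinAt_Icc {X X' : ℝ → E} {a b M : ℝ}
    (hX : ∀ r ∈ Icc a b, HasDerivWithinAt X (X' r) (Icc a b) r) (hM : ∀ r ∈ Icc a b, ‖X' r‖ ≤ M)
    {t r : ℝ} (ht : t ∈ Icc a b) (hr : r ∈ Icc a b) : ‖X r - X t‖ ≤ M * |r - t| :=
  (convex_Icc a b).norm_image_sub_le_of_norm_hasDerivWithin_le hX hM ht hr

theorem exists_isFlow [CompleteSpace E] {F : ℝ → E → E} {K : ℝ≥0} {M a b : ℝ} (hab : a ≤ b)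
    (hFc : Continuous fun q : ℝ × E => F q.1 q.2) (hFK : ∀ t, LipschitzWith K (F t))
    (hFM : ∀ t y, ‖F t y‖ ≤ M) : ∃ C Γ, IsFlow F a b M C Γ := by
  have hM0 : 0 ≤ M := (norm_nonneg _).trans (hFM 0 0)
  have hex : ∀ (t : Icc a b) (y : E), ∃ X : ℝ → E, X t = y ∧
      ∀ r ∈ Icc a b, HasDerivWithinAt X (F r (X r)) (Icc a b) r := by
    intro t y
    -- A field bounded by `M` moves a point by at most `M * (b - a)`, so a ball of this radius lets
    -- the solution live on all of `[a, b]`.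
    have hPL : IsPicardLindelof F t y (⟨M, hM0⟩ * ⟨b - a, sub_nonneg.2 hab⟩) 0 ⟨M, hM0⟩ K :=
      { lipschitzOnWith := fun s _ => (hFK s).lipschitzOnWith
        continuousOn := fun x _ => (hFc.comp (by fun_prop : Continuous fun s : ℝ => (s, x))).continuousOn
        norm_le := fun s _ x _ => hFM s x
        mul_max_le := by
          have h1 : max (b - (t : ℝ)) (t - a) ≤ b - a :=
            max_le (by linarith [t.2.1]) (by linarith [t.2.2])
          change M * max (b - (t : ℝ)) (t - a) ≤ M * (b - a) - 0
          rw [sub_zero]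
          exact mul_le_mul_of_nonneg_left h1 hM0 }
    exact hPL.exists_eq_forall_mem_Icc_hasDerivWithinAt₀
  choose X hX0 hX using hex
  have hdist : ∀ (t t' : Icc a b) (y y' : E) (r : Icc a b), dist (X t y r) (X t' y' r) ≤
      (dist y y' + M * |(t : ℝ) - t'|) * Real.exp (K * (b - a)) := by
    intro t t' y y' r
    refine (dist_le_of_hasDerivWithinAt_Icc hFK (hX t y) (hX t' y') t.2 r.2).trans ?_
    gcongr
    rw [hX0]
    have h1 := norm_sub_le_of_hasDerivWithinAt_Icc (hX t' y') (fun r _ => hFM r _) t'.2 t.2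
    rw [hX0, ← dist_eq_norm, dist_comm] at h1
    exact (dist_triangle y y' _).trans (by gcongr)
  have hlip : ∀ (t r : Icc a b), LipschitzWith (Real.toNNReal (Real.exp (K * (b - a))))
      fun y => X t y r := by
    intro t r
    refine LipschitzWith.of_dist_le' fun y y' => ?_
    simpa [mul_comm] using hdist t t y y' r
  have hcont : Continuous fun q : Icc a b × E × Icc a b => X q.1 q.2.1 q.2.2 := by
    rw [continuous_iff_continuousAt]
    rintro ⟨t, y, r⟩
    rw [ContinuousAt, tendsto_iff_dist_tendsto_zero]
    have hbd : ∀ q : Icc a b × E × Icc a b, dist (X q.1 q.2.1 q.2.2) (X t y r) ≤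
        (dist q.2.1 y + M * |(q.1 : ℝ) - t|) * Real.exp (K * (b - a)) + M * |(q.2.2 : ℝ) - r| := by
      intro q
      have h1 := norm_sub_le_of_hasDerivWithinAt_Icc (hX t y) (fun r _ => hFM r _) r.2 q.2.2.2
      rw [← dist_eq_norm] at h1
      exact (dist_triangle _ _ _).trans (add_le_add (hdist q.1 t q.2.1 y q.2.2) h1)
    refine squeeze_zero (fun _ => dist_nonneg) hbd ?_
    have : Continuous fun q : Icc a b × E × Icc a b =>
        (dist q.2.1 y + M * |(q.1 : ℝ) - t|) * Real.exp (K * (b - a)) + M * |(q.2.2 : ℝ) - r| := by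
      fun_prop
    exact this.tendsto' _ _ (by simp)
  have hval : ∀ (t : ℝ) (ht : t ∈ Icc a b), projIcc a b hab t = ⟨t, ht⟩ :=
    fun t ht => projIcc_of_mem hab ht
  -- Clamping both times to `[a, b]` makes the flow continuous on the whole product space.
  refine ⟨Real.toNNReal (Real.exp (K * (b - a))),
    fun t y r => X (projIcc a b hab t) y (projIcc a b hab r), hFc, hFM, ?_, ?_, ?_, ?_, ?_⟩
  · exact hcont.comp (by fun_prop : Continuous fun q : ℝ × E × ℝ =>
      (projIcc a b hab q.1, q.2.1, projIcc a b hab q.2.2))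
  · intro t ht y
    simp only [hval t ht]
    exact hX0 _ _
  · intro t ht y r hr
    simp only [hval r hr]
    refine (hX _ y r hr).congr (fun x hx => ?_) ?_
    · simp only [hval x hx]
    · simp only [hval r hr]
  · intro t _ r _
    exact hlip _ _
  · intro V hV t ht r hr
    simp only [hval t ht, hval r hr]
    have h := dist_le_of_hasDerivWithinAt_Icc hFK (hX ⟨t, ht⟩ (V t)) hV ht hr
    rw [hX0 ⟨t, ht⟩, dist_self, zero_mul] at h
    exact dist_le_zero.1 h

namespace IsFlow

open scoped NNReal

variable {F : ℝ → E → E} {a b M : ℝ} {C : ℝ≥0} {Γ : ℝ → E → ℝ → E}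

theorem comp (h : IsFlow F a b M C Γ) {t t' r : ℝ} (ht : t ∈ Icc a b) (ht' : t' ∈ Icc a b)
    (hr : r ∈ Icc a b) (y : E) : Γ t' (Γ t y t') r = Γ t y r :=
  h.eq_of_hasDerivWithinAt _ (h.hasDerivWithinAt t ht y) t' ht' r hr

theorem norm_sub_le (h : IsFlow F a b M C Γ) {t r : ℝ} (ht : t ∈ Icc a b) (hr : r ∈ Icc a b)
    (y : E) : ‖Γ t y r - y‖ ≤ M * |r - t| := by
  have h1 := norm_sub_le_of_hasDerivWithinAt_Icc (h.hasDerivWithinAt t ht y)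
    (fun r _ => h.norm_field_le r _) ht hr
  rwa [h.initial t ht] at h1

/-- The trajectory through `y` at time `t'` is at time `t` close to `y - (t' - t) • F t y`, because
the field along it stays close to `F t y`. Differentiating in the starting time needs no derivative
of the flow in space, so a Lipschitz flow is enough. -/
theorem hasDerivWithinAt_start (h : IsFlow F a b M C Γ) {t : ℝ} (ht : t ∈ Ico a b) (y : E) :
    HasDerivWithinAt (fun t' => Γ t' y t) (-(F t y)) (Ioi t) t := by
  have htI : t ∈ Icc a b := ⟨ht.1, ht.2.le⟩
  rw [hasDerivWithinAt_iff_isLittleO, Asymptotics.isLittleO_iff]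
  intro ε hε
  have hF := Metric.continuousAt_iff.1 (h.continuous_field.continuousAt (x := (t, y))) ε hε
  obtain ⟨δ, hδ, hF⟩ := hF
  have hM0 : 0 ≤ M := (norm_nonneg _).trans (h.norm_field_le 0 0)
  -- The first bound keeps the trajectory within `δ` of `y`, with `M + 1` in place of `M` in case `M
  -- = 0`; the second keeps the time within `δ` of `t`.
  have hη : 0 < min (δ / (M + 1)) δ := lt_min (by positivity) hδ
  filter_upwards [Ioo_mem_nhdsGT (lt_min ht.2 (lt_add_of_pos_right t hη))] with t' ht'
  have h1 : t' < b := ht'.2.trans_le (min_le_left _ _)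
  have h2 : t' < t + min (δ / (M + 1)) δ := ht'.2.trans_le (min_le_right _ _)
  have h3 : t' - t < δ / (M + 1) := by linarith [min_le_left (δ / (M + 1)) δ]
  have h4 : t' - t < δ := by linarith [min_le_right (δ / (M + 1)) δ]
  have ht'I : t' ∈ Icc a b := ⟨ht.1.trans ht'.1.le, h1.le⟩
  have hsub : Icc t t' ⊆ Icc a b := Icc_subset_Icc ht.1 h1.le
  have hd : ∀ r ∈ Icc t t', HasDerivWithinAt (fun r => Γ t' y r - r • F t y)
      (F r (Γ t' y r) - F t y) (Icc t t') r := by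
    intro r hr
    refine ((h.hasDerivWithinAt t' ht'I y r (hsub hr)).mono hsub).sub ?_
    simpa using ((hasDerivAt_id r).smul_const (F t y)).hasDerivWithinAt
  have hb : ∀ r ∈ Icc t t', ‖F r (Γ t' y r) - F t y‖ ≤ ε := by
    intro r hr
    rw [← dist_eq_norm]
    refine (hF (x := (r, Γ t' y r)) ?_).le
    rw [Prod.dist_eq, max_lt_iff]
    constructor
    · rw [Real.dist_eq, abs_of_nonneg (by linarith [hr.1])]
      linarith [hr.2]
    · simp only [dist_eq_norm]
      refine (h.norm_sub_le ht'I (hsub hr) y).trans_lt ?_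
      rw [abs_sub_comm, abs_of_nonneg (by linarith [hr.2])]
      have h5 : t' - r < δ / (M + 1) := by linarith [hr.1]
      rw [lt_div_iff₀ (by positivity)] at h5
      have h6 : 0 ≤ t' - r := by linarith [hr.2]
      nlinarith
  have h7 := norm_sub_le_of_hasDerivWithinAt_Icc hd hb (right_mem_Icc.2 ht'.1.le)
    (left_mem_Icc.2 ht'.1.le)
  rw [h.initial t' ht'I] at h7
  rw [h.initial t htI, Real.norm_eq_abs, abs_sub_comm t' t]
  refine le_trans (le_of_eq ?_) h7
  congr 1
  module

end IsFlow

end Flow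

/-! ### Integration by parts for Lipschitz functions -/

section Divergence

open scoped NNReal

variable {k : ℕ}

theorem EuclideanSpace.sum_smul_single (x : EuclideanSpace ℝ (Fin k)) :
    ∑ i, x i • EuclideanSpace.single i (1 : ℝ) = x := by
  simpa using (EuclideanSpace.basisFun (Fin k) ℝ).sum_repr x

/-- Integration by parts of a compactly supported Lipschitz function against a `C¹` field. -/
theorem integral_fderiv_add_mul_divergence_eq_zero {U : EuclideanSpace ℝ (Fin k) → ℝ}
    {V : EuclideanSpace ℝ (Fin k) → EuclideanSpace ℝ (Fin k)} {C : ℝ≥0}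
    (hU : LipschitzWith C U) (hUc : HasCompactSupport U) (hV : ContDiff ℝ 1 V) :
    ∫ y, (fderiv ℝ U y (V y) + U y * divergence V y) = 0 := by
  obtain ⟨R, hR⟩ : ∃ R, tsupport U ⊆ Metric.closedBall 0 R :=
    hUc.isCompact.isBounded.subset_closedBall 0
  -- `V` is cut off by a bump equal to `1` near the support of `U`, so that its components become
  -- compactly supported and Lipschitz. Rademacher's theorem then supplies the derivative of `U`
  -- almost everywhere.
  let χ : ContDiffBump (0 : EuclideanSpace ℝ (Fin k)) :=
    ⟨|R| + 1, |R| + 2, by positivity, by linarith⟩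
  have hχ1 : ∀ y ∈ tsupport U, (χ : EuclideanSpace ℝ (Fin k) → ℝ) =ᶠ[𝓝 y] 1 := by
    intro y hy
    refine χ.eventuallyEq_one_of_mem_ball ?_
    have := mem_closedBall_zero_iff.1 (hR hy)
    rw [mem_ball_zero_iff]
    change ‖y‖ < |R| + 1
    linarith [le_abs_self R]
  let W : Fin k → EuclideanSpace ℝ (Fin k) → ℝ := fun i y => χ y * V y i
  have hVi : ∀ i, ContDiff ℝ 1 fun y => V y i := contDiff_euclidean.1 hV
  have hW : ∀ i, ContDiff ℝ 1 (W i) := fun i => χ.contDiff.mul (hVi i)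
  have hWc : ∀ i, HasCompactSupport (W i) := fun i => χ.hasCompactSupport.mul_right
  have hparts : ∀ i, ∫ y, lineDeriv ℝ U y (EuclideanSpace.single i 1) * W i y
      = ∫ y, lineDeriv ℝ (W i) y (-EuclideanSpace.single i 1) * U y := by
    intro i
    obtain ⟨D, hD⟩ := (hW i).lipschitzWith_of_hasCompactSupport (hWc i) one_ne_zero
    exact hU.integral_lineDeriv_mul_eq hD (hWc i) _
  have hleft : (fun y => fderiv ℝ U y (V y)) =ᵐ[volume]
      fun y => ∑ i, lineDeriv ℝ U y (EuclideanSpace.single i 1) * W i y := by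
    filter_upwards [hU.ae_differentiableAt (μ := volume)] with y hy
    by_cases hyU : y ∈ tsupport U
    · conv_lhs => rw [← EuclideanSpace.sum_smul_single (V y)]
      rw [map_sum]
      refine Finset.sum_congr rfl fun i _ => ?_
      have h1 : χ y = 1 := (hχ1 y hyU).eq_of_nhds
      rw [map_smul, hy.lineDeriv_eq_fderiv, smul_eq_mul]
      simp only [W, h1, one_mul]
      ring
    · rw [fderiv_of_notMem_tsupport ℝ hyU]
      symm
      refine Finset.sum_eq_zero fun i _ => ?_
      rw [hy.lineDeriv_eq_fderiv, fderiv_of_notMem_tsupport ℝ hyU]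
      simp
  have hright : ∀ y, U y * divergence V y
      = -∑ i, lineDeriv ℝ (W i) y (-EuclideanSpace.single i 1) * U y := by
    intro y
    by_cases hyU : y ∈ tsupport U
    · rw [divergence, Finset.mul_sum, ← Finset.sum_neg_distrib]
      refine Finset.sum_congr rfl fun i _ => ?_
      have hWV : W i =ᶠ[𝓝 y] fun y => V y i := by
        filter_upwards [hχ1 y hyU] with z hz
        simp [W, hz]
      have hd : HasFDerivAt (fun z => V z i) ((EuclideanSpace.proj i).comp (fderiv ℝ V y)) y :=
        (EuclideanSpace.proj (𝕜 := ℝ) i).hasFDerivAt.comp y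
          (hV.differentiable one_ne_zero y).hasFDerivAt
      rw [((hW i).differentiable one_ne_zero y).lineDeriv_eq_fderiv, hWV.fderiv_eq, hd.fderiv]
      simp
      ring
    · rw [image_eq_zero_of_notMem_tsupport hyU]
      simp
  have hintl : ∀ i, Integrable fun y => lineDeriv ℝ U y (EuclideanSpace.single i 1) * W i y := by
    intro i
    refine Integrable.bdd_mul (c := C * ‖EuclideanSpace.single i (1 : ℝ)‖)
      ((hW i).continuous.integrable_of_hasCompactSupport (hWc i))
      (aestronglyMeasurable_lineDeriv hU.continuous _)
      (ae_of_all _ fun y => norm_lineDeriv_le_of_lipschitz ℝ hU)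
  have hintr : ∀ i, Integrable fun y =>
      lineDeriv ℝ (W i) y (-EuclideanSpace.single i 1) * U y := by
    intro i
    have h1 : (fun y => lineDeriv ℝ (W i) y (-EuclideanSpace.single i 1) * U y)
        = fun y => fderiv ℝ (W i) y (-EuclideanSpace.single i 1) * U y := by
      funext y
      rw [((hW i).differentiable one_ne_zero y).lineDeriv_eq_fderiv]
    rw [h1]
    have h2 := (hW i).continuous_fderiv one_ne_zero
    have h3 := hU.continuous
    exact Continuous.integrable_of_hasCompactSupport (by fun_prop) hUc.mul_left
  have hsum : (fun y => fderiv ℝ U y (V y) + U y * divergence V y) =ᵐ[volume]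
      fun y => ∑ i, (lineDeriv ℝ U y (EuclideanSpace.single i 1) * W i y
        - lineDeriv ℝ (W i) y (-EuclideanSpace.single i 1) * U y) := by
    filter_upwards [hleft] with y hy
    rw [hy, hright, Finset.sum_sub_distrib]
    ring
  rw [integral_congr_ae hsum, integral_finsetSum]
  swap
  · exact fun i _ => (hintl i).sub (hintr i)
  refine Finset.sum_eq_zero fun i _ => ?_
  rw [integral_sub (hintl i) (hintr i), hparts i, sub_self]

end Divergence

/-! ### Monotonicity of integrals against the density -/

section Monotone

open scoped NNReal

variable {k : ℕ} {ρ : ℝ → EuclideanSpace ℝ (Fin k) → ℝ}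
  {w : ℝ → EuclideanSpace ℝ (Fin k) → EuclideanSpace ℝ (Fin k)}

namespace IsClassicalDensityPath

theorem continuous_density (hρ : IsClassicalDensityPath ρ w) {t : ℝ} (ht : t ∈ Ioc (0 : ℝ) 1) :
    Continuous (ρ t) :=
  hρ.density_continuousOn.comp_continuous (f := fun z => (t, z)) (by fun_prop)
    fun z => ⟨ht, mem_univ z⟩

theorem continuous_velocity (hρ : IsClassicalDensityPath ρ w) {t : ℝ} (ht : t ∈ Ioc (0 : ℝ) 1) :
    Continuous (w t) :=
  hρ.velocity_continuousOn.comp_continuous (f := fun z => (t, z)) (by fun_prop)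
    fun z => ⟨ht, mem_univ z⟩

theorem contDiff_density (hρ : IsClassicalDensityPath ρ w) {t : ℝ} (ht : t ∈ Ioo (0 : ℝ) 1) :
    ContDiff ℝ 1 (ρ t) :=
  contDiffOn_univ.1 (hρ.density_contDiffOn.comp (g := fun q : ℝ × EuclideanSpace ℝ (Fin k) =>
    ρ q.1 q.2) (f := fun z => (t, z)) (by fun_prop) fun z _ => ⟨ht, mem_univ z⟩)

theorem contDiff_velocity (hρ : IsClassicalDensityPath ρ w) {t : ℝ} (ht : t ∈ Ioc (0 : ℝ) 1) :
    ContDiff ℝ 1 (w t) :=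
  contDiff_one_iff_fderiv.2 ⟨hρ.velocity_differentiable t ht,
    hρ.velocity_fderiv_continuousOn.comp_continuous (f := fun z => (t, z)) (by fun_prop)
      fun z => ⟨ht, mem_univ z⟩⟩

/-- Supplies the constant that dominates the time difference quotients of `ρ` on a ball. -/
theorem exists_abs_sub_le (hρ : IsClassicalDensityPath ρ w) {a b R : ℝ}
    (ha : 0 < a) (hb : b < 1) : ∃ B, ∀ t ∈ Icc a b, ∀ t' ∈ Icc a b, ∀ z, ‖z‖ ≤ R →
      |ρ t' z - ρ t z| ≤ B * |t' - t| := by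
  have hopen : IsOpen (Ioo (0 : ℝ) 1 ×ˢ (univ : Set (EuclideanSpace ℝ (Fin k)))) :=
    isOpen_Ioo.prod isOpen_univ
  have hsub : Icc a b ×ˢ Metric.closedBall (0 : EuclideanSpace ℝ (Fin k)) R ⊆ Ioo 0 1 ×ˢ univ :=
    prod_mono (fun t ht => ⟨ha.trans_le ht.1, ht.2.trans_lt hb⟩) (subset_univ _)
  have hc := (hρ.density_contDiffOn.continuousOn_fderiv_of_isOpen hopen le_rfl).mono hsub
  obtain ⟨B, hB⟩ := (isCompact_Icc.prod (isCompact_closedBall _ _)).exists_bound_of_continuousOn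
    (hc.clm_apply (continuousOn_const (c := ((1 : ℝ), (0 : EuclideanSpace ℝ (Fin k))))))
  refine ⟨B, fun t ht t' ht' z hz => ?_⟩
  have hzB : z ∈ Metric.closedBall (0 : EuclideanSpace ℝ (Fin k)) R := mem_closedBall_zero_iff.2 hz
  refine norm_sub_le_of_hasDerivWithinAt_Icc (X := fun r => ρ r z) (fun r hr => ?_)
    (fun r hr => hB (r, z) ⟨hr, hzB⟩) ht ht'
  have h1 := ((hρ.density_contDiffOn.contDiffAt (hopen.mem_nhds (hsub (⟨hr, hzB⟩ :
    (r, z) ∈ Icc a b ×ˢ Metric.closedBall 0 R)))).differentiableAt one_ne_zero).hasFDerivAt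
  exact (h1.comp_hasDerivAt r ((hasDerivAt_id r).prodMk (hasDerivAt_const r z))).hasDerivWithinAt

end IsClassicalDensityPath

/-- If `u` does not increase backwards along the trajectories of `-w`, then the integral of `u`
against `ρ` does not increase in time. -/
theorem integral_mul_density_le (hρ : IsClassicalDensityPath ρ w)
    (hc : ReverseContinuityEquation ρ w)
    {F : ℝ → EuclideanSpace ℝ (Fin k) → EuclideanSpace ℝ (Fin k)} {a M : ℝ} {C : ℝ≥0}
    {Γ : ℝ → EuclideanSpace ℝ (Fin k) → ℝ → EuclideanSpace ℝ (Fin k)} (hΓ : IsFlow F a 1 M C Γ)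
    {s R : ℝ} (ha : 0 < a) (hs : s ∈ Ico a 1)
    (hF : ∀ t ∈ Icc a 1, ∀ z, ‖z‖ ≤ R → F t z = -w t z)
    {u : ℝ → EuclideanSpace ℝ (Fin k) → ℝ} {L : ℝ≥0}
    (hu : Continuous fun q : ℝ × EuclideanSpace ℝ (Fin k) => u q.1 q.2)
    (huL : ∀ t ∈ Icc s 1, LipschitzWith L (u t))
    (hsupp : ∀ t ∈ Icc s 1, ∀ y, R ≤ ‖y‖ → u t y = 0)
    (hmono : ∀ t' ∈ Icc s 1, ∀ t ∈ Icc s 1, t' ≤ t → ∀ y, u t y ≤ u t' (Γ t y t')) :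
    ∫ y, u 1 y * ρ 1 y ≤ ∫ y, u s y * ρ s y := by
  have hs0 : 0 < s := ha.trans_le hs.1
  have hM0 : 0 ≤ M := (norm_nonneg _).trans (hΓ.norm_field_le 0 0)
  have hIcc : ∀ t ∈ Icc s 1, t ∈ Icc a 1 := fun t ht => ⟨hs.1.trans ht.1, ht.2⟩
  have hIoc : ∀ t ∈ Icc s 1, t ∈ Ioc (0 : ℝ) 1 := fun t ht => ⟨hs0.trans_le ht.1, ht.2⟩
  have hcont : ContinuousOn (fun t => ∫ y, u t y * ρ t y) (Icc s 1) := by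
    refine continuousOn_integral_of_compact_support
      (isCompact_closedBall (0 : EuclideanSpace ℝ (Fin k)) R) ?_ ?_
    · exact hu.continuousOn.mul (hρ.density_continuousOn.mono
        (prod_mono (fun t ht => hIoc t ht) le_rfl))
    · intro t y ht hy
      rw [mem_closedBall_zero_iff, not_le] at hy
      rw [hsupp t ht y hy.le, zero_mul]
  -- Since `u` need not be differentiable in time, the decrease is read off the right lower slopes:
  -- it suffices that at each `t₀` they fall below every `r > 0`.
  refine image_le_of_liminf_slope_right_le_deriv_boundary hcont le_rfl
    (B := fun _ => ∫ y, u s y * ρ s y) (B' := fun _ => 0) continuousOn_const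
    (fun x _ => hasDerivWithinAt_const _ _ _) ?_ (right_mem_Icc.2 hs.2.le)
  intro t₀ ht₀ r hr
  have ht₀I : t₀ ∈ Icc s 1 := ⟨ht₀.1, ht₀.2.le⟩
  have ht₀0 : 0 < t₀ := hs0.trans_le ht₀.1
  have ht₀O : t₀ ∈ Ioo (0 : ℝ) 1 := ⟨ht₀0, ht₀.2⟩
  obtain ⟨t₁, ht₁, ht₁'⟩ := exists_between ht₀.2
  let V : EuclideanSpace ℝ (Fin k) → EuclideanSpace ℝ (Fin k) := fun y => ρ t₀ y • w t₀ y
  have hV : ContDiff ℝ 1 V :=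
    (hρ.contDiff_density ht₀O).smul (hρ.contDiff_velocity (hIoc t₀ ht₀I))
  have hUc : HasCompactSupport (u t₀) := by
    refine HasCompactSupport.intro (isCompact_closedBall (0 : EuclideanSpace ℝ (Fin k)) R) ?_
    intro y hy
    rw [mem_closedBall_zero_iff, not_le] at hy
    exact hsupp t₀ ht₀I y hy.le
  -- Freeze `u` at time `t₀` and transport it exactly by the flow. By `hmono` this dominates `u t`
  -- for `t ≥ t₀` and agrees at `t₀`; the right derivative of its integral at `t₀` is that of a pure
  -- divergence, hence zero.
  let q : ℝ → EuclideanSpace ℝ (Fin k) → ℝ := fun t y => u t₀ (Γ t y t₀) * ρ t y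
  -- Times in `[t₀, 1]` differ by at most `1`, so the flow moves points by at most `M`.
  let K := Metric.closedBall (0 : EuclideanSpace ℝ (Fin k)) (R + M)
  have hK : IsCompact K := isCompact_closedBall _ _
  have hqsupp : ∀ t ∈ Icc t₀ 1, ∀ y ∉ K, q t y = 0 := by
    intro t ht y hy
    have h1 := hΓ.norm_sub_le (hIcc t ⟨ht₀.1.trans ht.1, ht.2⟩) (hIcc t₀ ht₀I) y
    have h2 : M * |t₀ - t| ≤ M := by
      rw [abs_sub_comm, abs_of_nonneg (by linarith [ht.1])]
      nlinarith [ht.2]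
    have h3 : R + M < ‖y‖ := by simpa [K] using hy
    have h4 := norm_sub_norm_le y (Γ t y t₀)
    rw [norm_sub_rev] at h4
    have h5 : u t₀ (Γ t y t₀) = 0 := hsupp t₀ ht₀I _ (by linarith)
    simp only [q, h5, zero_mul]
  have hΓc : ∀ t, Continuous fun y => Γ t y t₀ := fun t =>
    hΓ.continuous.comp (by fun_prop : Continuous fun y : EuclideanSpace ℝ (Fin k) => (t, y, t₀))
  have huc : ∀ t, Continuous (u t) := fun t =>
    hu.comp (by fun_prop : Continuous fun y : EuclideanSpace ℝ (Fin k) => (t, y))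
  have hqc : ∀ t ∈ Icc t₀ 1, Continuous (q t) := fun t ht =>
    ((huc t₀).comp (hΓc t)).mul (hρ.continuous_density ⟨ht₀0.trans_le ht.1, ht.2⟩)
  have hqint : ∀ t ∈ Icc t₀ 1, Integrable (q t) := fun t ht =>
    (hqc t ht).integrable_of_hasCompactSupport (HasCompactSupport.intro hK (hqsupp t ht))
  have hq0 : ∀ y, q t₀ y = u t₀ y * ρ t₀ y := by
    intro y
    simp only [q, hΓ.initial t₀ (hIcc t₀ ht₀I)]
  obtain ⟨A, hA⟩ : ∃ A, ∀ t ∈ Icc t₀ t₁, ∀ y ∈ K, |ρ t y| ≤ A := by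
    obtain ⟨A, hA⟩ := ((isCompact_Icc (a := t₀) (b := t₁)).prod hK).exists_bound_of_continuousOn
      (hρ.density_continuousOn.mono (prod_mono
        (fun t ht => ⟨ht₀0.trans_le ht.1, ht.2.trans ht₁'.le⟩) (subset_univ _)))
    exact ⟨A, fun t ht y hy => hA (t, y) ⟨ht, hy⟩⟩
  obtain ⟨A', hA'⟩ := hK.exists_bound_of_continuousOn (huc t₀).continuousOn
  obtain ⟨B, hB⟩ := hρ.exists_abs_sub_le (R := R + M) ht₀0 ht₁'
  have hderiv : ∀ᵐ y, HasDerivWithinAt (fun t => q t y)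
      (fderiv ℝ (u t₀) y (V y) + u t₀ y * divergence V y) (Ioi t₀) t₀ := by
    filter_upwards [(huL t₀ ht₀I).ae_differentiableAt (μ := volume)] with y hy
    have h1 := hΓ.hasDerivWithinAt_start ⟨hs.1.trans ht₀.1, ht₀.2⟩ y
    have h2 : HasFDerivAt (u t₀) (fderiv ℝ (u t₀) y) (Γ t₀ y t₀) := by
      rw [hΓ.initial t₀ (hIcc t₀ ht₀I)]
      exact hy.hasFDerivAt
    have h3 := (h2.comp_hasDerivWithinAt (f := fun t' => Γ t' y t₀) t₀ h1).mul (hc t₀ ht₀O y).hasDerivWithinAt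
    refine h3.congr_deriv ?_
    simp only [Function.comp, hΓ.initial t₀ (hIcc t₀ ht₀I)]
    congr 1
    by_cases hyR : ‖y‖ ≤ R
    · rw [hF t₀ (hIcc t₀ ht₀I) y hyR, neg_neg, map_smul, smul_eq_mul, mul_comm]
    · have h4 : u t₀ =ᶠ[𝓝 y] fun _ => 0 := by
        filter_upwards [(isOpen_lt continuous_const continuous_norm).mem_nhds
          (not_le.1 hyR)] with z hz
        exact hsupp t₀ ht₀I z (le_of_lt hz)
      rw [h4.fderiv_eq]
      simp
  have hlim : Tendsto (fun t => ∫ y, (t - t₀)⁻¹ * (q t y - q t₀ y)) (𝓝[>] t₀) (𝓝 0) := by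
    rw [← integral_fderiv_add_mul_divergence_eq_zero (huL t₀ ht₀I) hUc hV]
    have hev : ∀ᶠ t in 𝓝[>] t₀, t ∈ Ioo t₀ t₁ := Ioo_mem_nhdsGT ht₁
    refine tendsto_integral_filter_of_dominated_convergence
      (K.indicator fun _ => L * M * A + A' * B) ?_ ?_ ?_ ?_
    · filter_upwards [hev] with t ht
      exact (((hqc t ⟨ht.1.le, (ht.2.trans ht₁').le⟩).sub
        (hqc t₀ ⟨le_rfl, ht₀.2.le⟩)).const_mul _).aestronglyMeasurable
    · filter_upwards [hev] with t ht
      refine ae_of_all _ fun y => ?_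
      have htI : t ∈ Icc t₀ 1 := ⟨ht.1.le, (ht.2.trans ht₁').le⟩
      have htI' : t ∈ Icc s 1 := ⟨ht₀.1.trans ht.1.le, htI.2⟩
      have hpos : 0 < t - t₀ := sub_pos.2 ht.1
      by_cases hy : y ∈ K
      · rw [indicator_of_mem hy, norm_mul, norm_inv, Real.norm_eq_abs, abs_of_pos hpos,
          inv_mul_le_iff₀ hpos, hq0]
        have e1 : |u t₀ (Γ t y t₀) - u t₀ y| ≤ L * (M * (t - t₀)) := by
          refine ((huL t₀ ht₀I).norm_sub_le _ _).trans ?_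
          gcongr
          refine (hΓ.norm_sub_le (hIcc t htI') (hIcc t₀ ht₀I) y).trans ?_
          rw [abs_sub_comm, abs_of_pos hpos]
        have e2 : |ρ t y - ρ t₀ y| ≤ B * (t - t₀) := by
          have := hB t₀ ⟨le_rfl, ht₁.le⟩ t ⟨ht.1.le, ht.2.le⟩ y (by simpa [K] using hy)
          rwa [abs_of_pos hpos] at this
        have e3 : |ρ t y| ≤ A := hA t ⟨ht.1.le, ht.2.le⟩ y hy
        have e4 : |u t₀ y| ≤ A' := hA' y hy
        calc ‖q t y - u t₀ y * ρ t₀ y‖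
            = |(u t₀ (Γ t y t₀) - u t₀ y) * ρ t y + u t₀ y * (ρ t y - ρ t₀ y)| := by
              rw [Real.norm_eq_abs]
              congr 1
              simp only [q]
              ring
          _ ≤ |u t₀ (Γ t y t₀) - u t₀ y| * |ρ t y| + |u t₀ y| * |ρ t y - ρ t₀ y| := by
              rw [← abs_mul, ← abs_mul]
              exact abs_add_le _ _
          _ ≤ (L * (M * (t - t₀))) * A + A' * (B * (t - t₀)) := by
              refine add_le_add (mul_le_mul e1 e3 (abs_nonneg _) (by positivity))
                (mul_le_mul e4 e2 (abs_nonneg _) ((abs_nonneg _).trans e4))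
          _ = (t - t₀) * (L * M * A + A' * B) := by ring
      · rw [indicator_of_notMem hy, hqsupp t htI y hy, hqsupp t₀ ⟨le_rfl, ht₀.2.le⟩ y hy]
        simp
    · exact (integrable_indicator_iff hK.measurableSet).2 (integrableOn_const hK.measure_ne_top)
    · filter_upwards [hderiv] with y hy
      have := (hasDerivWithinAt_iff_tendsto_slope' (by simp)).1 hy
      simpa only [slope_def_module, smul_eq_mul, slope_fun_def, vsub_eq_sub] using this
  refine Eventually.frequently ?_
  have hev : ∀ᶠ t in 𝓝[>] t₀, t ∈ Ioo t₀ t₁ := Ioo_mem_nhdsGT ht₁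
  filter_upwards [hlim.eventually_lt_const hr, hev] with t hlt ht
  refine lt_of_le_of_lt ?_ hlt
  have htI : t ∈ Icc t₀ 1 := ⟨ht.1.le, (ht.2.trans ht₁').le⟩
  have htI' : t ∈ Icc s 1 := ⟨ht₀.1.trans ht.1.le, htI.2⟩
  have h0I : t₀ ∈ Icc t₀ 1 := ⟨le_rfl, ht₀.2.le⟩
  rw [integral_const_mul, integral_sub (hqint t htI) (hqint t₀ h0I), slope_def_module, smul_eq_mul]
  simp only [hq0]
  have hpos : 0 < t - t₀ := sub_pos.2 ht.1
  refine mul_le_mul_of_nonneg_left (sub_le_sub_right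
    (integral_mono ?_ (hqint t htI) fun y => ?_) _) (inv_nonneg.2 hpos.le)
  · refine ((huc t).mul (hρ.continuous_density (hIoc t htI'))).integrable_of_hasCompactSupport
      (HasCompactSupport.intro (isCompact_closedBall (0 : EuclideanSpace ℝ (Fin k)) R) ?_)
    intro y hy
    rw [mem_closedBall_zero_iff, not_le] at hy
    rw [Pi.mul_apply, hsupp t htI' y hy.le, zero_mul]
  · exact mul_le_mul_of_nonneg_right (hmono t₀ ht₀I t htI' ht.1.le y)
      (hρ.nonneg t (hIoc t htI') y)

end Monotone

/-! ### Trajectories kept in a ball are dominated by the density -/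

section Pushforward

open scoped NNReal

theorem lipschitzWith_sInf_image {X β : Type*} [PseudoMetricSpace X] {f : X → β → ℝ} {K : Set β}
    {L : ℝ≥0} (hK : K.Nonempty) (hb : ∀ x, BddBelow (f x '' K))
    (hf : ∀ b ∈ K, LipschitzWith L fun x => f x b) : LipschitzWith L fun x => sInf (f x '' K) := by
  refine LipschitzWith.of_le_add_mul L fun x y => ?_
  rw [← sub_le_iff_le_add]
  refine le_csInf (hK.image _) ?_
  rintro _ ⟨b, hbK, rfl⟩
  rw [sub_le_iff_le_add]
  exact (csInf_le (hb x) (mem_image_of_mem _ hbK)).trans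
    (sub_le_iff_le_add'.1 ((le_abs_self _).trans ((hf b hbK).dist_le_mul x y)))

theorem isOpen_setOf_forall_mem_lt {X β : Type*} [TopologicalSpace X] [TopologicalSpace β]
    {f : X → β → ℝ} {K : Set β} (hK : IsCompact K) (hf : Continuous fun q : X × β => f q.1 q.2)
    (c : ℝ) : IsOpen {x | ∀ b ∈ K, f x b < c} := by
  rw [isOpen_iff_eventually]
  intro x hx
  refine hK.eventually_forall_of_forall_eventually fun b hb => ?_
  exact (hf.tendsto (x, b)).eventually_lt_const (hx b hb)

theorem MeasureTheory.Measure.le_of_forall_isClosed {X : Type*} [TopologicalSpace X]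
    [MeasurableSpace X] {μ ν : Measure X} [μ.WeaklyRegular] [IsFiniteMeasure μ]
    (h : ∀ D, IsClosed D → μ D ≤ ν D) : μ ≤ ν := by
  refine Measure.le_iff.2 fun A hA => ?_
  rw [hA.measure_eq_iSup_isClosed_of_ne_top (measure_ne_top μ A)]
  exact iSup₂_le fun D hDA => iSup_le fun hD => (h D hD).trans (measure_mono hDA)

variable {k : ℕ} {ρ : ℝ → EuclideanSpace ℝ (Fin k) → ℝ}
  {w : ℝ → EuclideanSpace ℝ (Fin k) → EuclideanSpace ℝ (Fin k)}

namespace IsClassicalDensityPath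

theorem isProbabilityMeasure (hρ : IsClassicalDensityPath ρ w) {t : ℝ} (ht : t ∈ Ioc (0 : ℝ) 1) :
    IsProbabilityMeasure (volume.withDensity fun z => ENNReal.ofReal (ρ t z)) :=
  ⟨by rw [withDensity_apply _ MeasurableSet.univ, Measure.restrict_univ, hρ.lintegral_eq_one t ht]⟩

theorem lintegral_withDensity_ofReal (hρ : IsClassicalDensityPath ρ w) {t : ℝ}
    (ht : t ∈ Ioc (0 : ℝ) 1) {f : EuclideanSpace ℝ (Fin k) → ℝ} (hf : Continuous f)
    (hfc : HasCompactSupport f) (hf0 : ∀ z, 0 ≤ f z) :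
    ∫⁻ z, ENNReal.ofReal (f z) ∂(volume.withDensity fun z => ENNReal.ofReal (ρ t z))
      = ENNReal.ofReal (∫ z, f z * ρ t z) := by
  have hρc := hρ.continuous_density ht
  rw [lintegral_withDensity_eq_lintegral_mul _ (by fun_prop) (by fun_prop),
    ofReal_integral_eq_lintegral_ofReal]
  · refine lintegral_congr fun z => ?_
    rw [Pi.mul_apply, ← ENNReal.ofReal_mul (hρ.nonneg t ht z), mul_comm]
  · exact (hf.mul hρc).integrable_of_hasCompactSupport hfc.mul_right
  · exact ae_of_all _ fun z => mul_nonneg (hf0 z) (hρ.nonneg t ht z)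

/-- On a ball the velocity field agrees with a bounded Lipschitz field, which has a flow. -/
theorem exists_isFlow (hρ : IsClassicalDensityPath ρ w) {a : ℝ} (ha : 0 < a) (ha1 : a ≤ 1)
    (R : ℝ) : ∃ F M C Γ, IsFlow F a 1 M C Γ ∧ ∀ t ∈ Icc a 1, ∀ z, ‖z‖ ≤ R → F t z = -w t z := by
  let χ : ContDiffBump (0 : EuclideanSpace ℝ (Fin k)) :=
    ⟨|R| + 1, |R| + 2, by positivity, by linarith⟩
  have hI : ∀ τ : Icc a 1, (τ : ℝ) ∈ Ioc (0 : ℝ) 1 := fun τ => ⟨ha.trans_le τ.2.1, τ.2.2⟩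
  let G : Icc a 1 → EuclideanSpace ℝ (Fin k) → EuclideanSpace ℝ (Fin k) :=
    fun τ z => χ z • w τ z
  have hwc : Continuous fun q : Icc a 1 × EuclideanSpace ℝ (Fin k) => w q.1 q.2 :=
    hρ.velocity_continuousOn.comp_continuous
      (f := fun q : Icc a 1 × EuclideanSpace ℝ (Fin k) => ((q.1 : ℝ), q.2)) (by fun_prop)
      fun q => ⟨hI q.1, mem_univ _⟩
  have hDwc : Continuous fun q : Icc a 1 × EuclideanSpace ℝ (Fin k) => fderiv ℝ (w q.1) q.2 :=
    hρ.velocity_fderiv_continuousOn.comp_continuous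
      (f := fun q : Icc a 1 × EuclideanSpace ℝ (Fin k) => ((q.1 : ℝ), q.2)) (by fun_prop)
      fun q => ⟨hI q.1, mem_univ _⟩
  have hχc : Continuous χ := χ.continuous
  have hDχ : Continuous (fderiv ℝ χ) := (χ.contDiff (n := 1)).continuous_fderiv one_ne_zero
  have hGc : Continuous fun q : Icc a 1 × EuclideanSpace ℝ (Fin k) => G q.1 q.2 :=
    (hχc.comp continuous_snd).smul hwc
  -- The space derivative of the cut-off field `G`. It is continuous and vanishes off a compact set,
  -- so its bound is a Lipschitz constant uniform in time.
  let D : Icc a 1 × EuclideanSpace ℝ (Fin k) →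
      EuclideanSpace ℝ (Fin k) →L[ℝ] EuclideanSpace ℝ (Fin k) :=
    fun q => χ q.2 • fderiv ℝ (w q.1) q.2 + (fderiv ℝ χ q.2).smulRight (w q.1 q.2)
  have hDc : Continuous D := by
    refine ((hχc.comp continuous_snd).smul hDwc).add ?_
    exact (((ContinuousLinearMap.smulRightL ℝ (EuclideanSpace ℝ (Fin k))
      (EuclideanSpace ℝ (Fin k))).continuous.comp (hDχ.comp continuous_snd)).clm_apply hwc)
  have hDG : ∀ τ z, HasFDerivAt (G τ) (D (τ, z)) z := fun τ z =>
    ((χ.contDiff (n := 1)).differentiable one_ne_zero z).hasFDerivAt.smul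
      (hρ.velocity_differentiable τ (hI τ) z).hasFDerivAt
  let B := Metric.closedBall (0 : EuclideanSpace ℝ (Fin k)) (|R| + 2)
  have hcomp : IsCompact ((univ : Set (Icc a 1)) ×ˢ B) :=
    isCompact_univ.prod (isCompact_closedBall _ _)
  have hsupp : tsupport χ ⊆ B := χ.tsupport_eq.subset
  have hout : ∀ z ∉ B, χ z = 0 ∧ fderiv ℝ χ z = 0 := fun z hz =>
    ⟨image_eq_zero_of_notMem_tsupport fun h => hz (hsupp h),
      fderiv_of_notMem_tsupport ℝ fun h => hz (hsupp h)⟩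
  obtain ⟨M, hM⟩ := hcomp.exists_bound_of_continuousOn hGc.continuousOn
  obtain ⟨K, hK⟩ := hcomp.exists_bound_of_continuousOn hDc.continuousOn
  have hGM : ∀ τ z, ‖G τ z‖ ≤ |M| := by
    intro τ z
    by_cases hz : z ∈ B
    · exact (hM (τ, z) ⟨mem_univ _, hz⟩).trans (le_abs_self M)
    · simp [G, (hout z hz).1]
  have hDK : ∀ q, ‖D q‖₊ ≤ Real.toNNReal |K| := by
    rintro ⟨τ, z⟩
    rw [← NNReal.coe_le_coe, Real.coe_toNNReal _ (abs_nonneg K), coe_nnnorm]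
    by_cases hz : z ∈ B
    · exact (hK (τ, z) ⟨mem_univ _, hz⟩).trans (le_abs_self K)
    · have h0 : D (τ, z) = 0 := by
        ext x
        simp [D, (hout z hz).1, (hout z hz).2]
      rw [h0, norm_zero]
      exact abs_nonneg K
  have hGL : ∀ τ, LipschitzWith (Real.toNNReal |K|) (G τ) := by
    intro τ
    refine lipschitzWith_of_nnnorm_fderiv_le (𝕜 := ℝ)
      (fun z => (hDG τ z).differentiableAt) fun z => ?_
    rw [(hDG τ z).fderiv]
    exact hDK _
  obtain ⟨C, Γ, hΓ⟩ := _root_.exists_isFlow (F := fun t z => -G (projIcc a 1 ha1 t) z)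
    (K := Real.toNNReal |K|) (M := |M|) ha1
    (hGc.comp (by fun_prop : Continuous fun q : ℝ × EuclideanSpace ℝ (Fin k) =>
      (projIcc a 1 ha1 q.1, q.2))).neg (fun t => (hGL _).neg)
    (fun t y => by rw [norm_neg]; exact hGM _ _)
  refine ⟨_, _, C, Γ, hΓ, fun t ht z hz => ?_⟩
  have h1 : χ z = 1 := by
    refine χ.one_of_mem_closedBall (mem_closedBall_zero_iff.2 ?_)
    change ‖z‖ ≤ |R| + 1
    linarith [le_abs_self R]
  simp only [G, h1, one_smul, projIcc_of_mem ha1 ht]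

end IsClassicalDensityPath

variable {F : ℝ → EuclideanSpace ℝ (Fin k) → EuclideanSpace ℝ (Fin k)} {a M : ℝ} {C : ℝ≥0}
  {Γ : ℝ → EuclideanSpace ℝ (Fin k) → ℝ → EuclideanSpace ℝ (Fin k)}

theorem IsFlow.continuous_eval {b : ℝ} (hΓ : IsFlow F a b M C Γ) (t r : ℝ) :
    Continuous fun y => Γ t y r :=
  hΓ.continuous.comp (by fun_prop : Continuous fun y : EuclideanSpace ℝ (Fin k) => (t, y, r))

theorem IsFlow.isOpen_setOf_norm_lt {b : ℝ} (hΓ : IsFlow F a b M C Γ) (t s R : ℝ) :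
    IsOpen {x | ∀ r ∈ Icc s b, ‖Γ t x r‖ < R} := by
  have h : Continuous fun q : EuclideanSpace ℝ (Fin k) × ℝ => ‖Γ t q.1 q.2‖ :=
    (hΓ.continuous.comp (by fun_prop : Continuous fun q : EuclideanSpace ℝ (Fin k) × ℝ =>
      (t, q.1, q.2))).norm
  exact isOpen_setOf_forall_mem_lt isCompact_Icc h R

/-- The points that start at time `1` with law `ρ 1` and whose trajectories stay in a ball until
time `s` have at time `s` a law that is dominated by `ρ s`: version with test functions. -/
theorem lintegral_min_sInf_le (hρ : IsClassicalDensityPath ρ w)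
    (hc : ReverseContinuityEquation ρ w) (hΓ : IsFlow F a 1 M C Γ) {s R : ℝ} (ha : 0 < a)
    (hs : s ∈ Ico a 1) (hF : ∀ t ∈ Icc a 1, ∀ z, ‖z‖ ≤ R → F t z = -w t z)
    {φ : EuclideanSpace ℝ (Fin k) → ℝ} {L : ℝ≥0} (hφ : LipschitzWith L φ) (hφ0 : ∀ z, 0 ≤ φ z)
    (m : ℕ) :
    ∫⁻ x, ENNReal.ofReal (min (φ (Γ 1 x s))
        (sInf ((fun r => m * max 0 (R - ‖Γ 1 x (min r 1)‖)) '' Icc s 1)))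
        ∂(volume.withDensity fun z => ENNReal.ofReal (ρ 1 z))
      ≤ ∫⁻ y, ENNReal.ofReal (φ y) ∂(volume.withDensity fun z => ENNReal.ofReal (ρ s z)) := by
  have hs0 : 0 < s := ha.trans_le hs.1
  have hIcc : ∀ t ∈ Icc s 1, t ∈ Icc a 1 := fun t ht => ⟨hs.1.trans ht.1, ht.2⟩
  have hs1 : s ∈ Icc s 1 := ⟨le_rfl, hs.2.le⟩
  have h11 : (1 : ℝ) ∈ Icc s 1 := ⟨hs.2.le, le_rfl⟩
  have hne : (Icc s 1).Nonempty := ⟨s, hs1⟩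
  let g : EuclideanSpace ℝ (Fin k) → ℝ := fun z => m * max 0 (R - ‖z‖)
  have hg0 : ∀ z, 0 ≤ g z := fun z => by positivity
  have hgL : LipschitzWith m g := by
    refine LipschitzWith.of_le_add_mul _ fun x y => ?_
    have h1 : max 0 (R - ‖x‖) ≤ max 0 (R - ‖y‖) + dist x y := by
      have h2 := norm_sub_norm_le y x
      rw [← dist_eq_norm, dist_comm] at h2
      refine max_le (by positivity) ?_
      linarith [le_max_right 0 (R - ‖y‖)]
    have h3 := mul_le_mul_of_nonneg_left h1 (Nat.cast_nonneg (α := ℝ) m)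
    simpa [g, mul_add] using h3
  -- The first term carries `φ` along the trajectory. The second kills trajectories that have
  -- reached norm `R` between times `s` and `t`; writing `min r t` over the fixed interval `[s, 1]`
  -- keeps it jointly continuous. Going back in time, fewer `r` are tested, so `u` can only grow.
  let u : ℝ → EuclideanSpace ℝ (Fin k) → ℝ := fun t y =>
    min (φ (Γ t y s)) (sInf ((fun r => g (Γ t y (min r t))) '' Icc s 1))
  have hbdd : ∀ t y, BddBelow ((fun r => g (Γ t y (min r t))) '' Icc s 1) := by
    refine fun t y => ⟨0, ?_⟩
    rintro _ ⟨r, _, rfl⟩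
    exact hg0 _
  have hu : Continuous fun q : ℝ × EuclideanSpace ℝ (Fin k) => u q.1 q.2 := by
    refine Continuous.min (hφ.continuous.comp (hΓ.continuous.comp
      (by fun_prop : Continuous fun q : ℝ × EuclideanSpace ℝ (Fin k) => (q.1, q.2, s)))) ?_
    refine isCompact_Icc.continuous_sInf
      (f := fun (q : ℝ × EuclideanSpace ℝ (Fin k)) r => g (Γ q.1 q.2 (min r q.1))) ?_
    exact hgL.continuous.comp (hΓ.continuous.comp
      (by fun_prop : Continuous fun q : (ℝ × EuclideanSpace ℝ (Fin k)) × ℝ =>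
        (q.1.1, q.1.2, min q.2 q.1.1)))
  have hu0 : ∀ t y, 0 ≤ u t y := fun t y => by
    refine le_min (hφ0 _) (le_csInf (hne.image _) ?_)
    rintro _ ⟨r, _, rfl⟩
    exact hg0 _
  have hmin : ∀ {r t : ℝ}, r ∈ Icc s 1 → t ∈ Icc s 1 → min r t ∈ Icc s 1 := fun hr ht =>
    ⟨le_min hr.1 ht.1, (min_le_left _ _).trans hr.2⟩
  have huL : ∀ t ∈ Icc s 1, LipschitzWith (max (L * C) (m * C)) (u t) := fun t ht =>
    (hφ.comp (hΓ.lipschitz t (hIcc t ht) s (hIcc s hs1))).min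
      (lipschitzWith_sInf_image hne (hbdd t) fun r hr =>
        hgL.comp (hΓ.lipschitz t (hIcc t ht) _ (hIcc _ (hmin hr ht))))
  have hsupp : ∀ t ∈ Icc s 1, ∀ y, R ≤ ‖y‖ → u t y = 0 := by
    intro t ht y hy
    refine le_antisymm ?_ (hu0 t y)
    refine (min_le_right _ _).trans ((csInf_le (hbdd t y) (mem_image_of_mem _ ht)).trans ?_)
    rw [min_self, hΓ.initial t (hIcc t ht)]
    simp [g, max_eq_left (sub_nonpos.2 hy)]
  have hmono : ∀ t' ∈ Icc s 1, ∀ t ∈ Icc s 1, t' ≤ t → ∀ y, u t y ≤ u t' (Γ t y t') := by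
    intro t' ht' t ht htt y
    refine le_min ((min_le_left _ _).trans_eq ?_) (le_csInf (hne.image _) ?_)
    · rw [hΓ.comp (hIcc t ht) (hIcc t' ht') (hIcc s hs1)]
    · rintro _ ⟨r, hr, rfl⟩
      refine (min_le_right _ _).trans ?_
      refine (csInf_le (hbdd t y) (mem_image_of_mem _ (hmin hr ht'))).trans_eq ?_
      simp only
      rw [hΓ.comp (hIcc t ht) (hIcc t' ht') (hIcc _ (hmin hr ht')),
        min_eq_left ((min_le_right r t').trans htt)]
  have hcs : ∀ t ∈ Icc s 1, HasCompactSupport (u t) := by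
    intro t ht
    refine HasCompactSupport.intro (isCompact_closedBall (0 : EuclideanSpace ℝ (Fin k)) R) ?_
    intro y hy
    rw [mem_closedBall_zero_iff, not_le] at hy
    exact hsupp t ht y hy.le
  have hIoc : ∀ t ∈ Icc s 1, t ∈ Ioc (0 : ℝ) 1 := fun t ht => ⟨hs0.trans_le ht.1, ht.2⟩
  calc ∫⁻ x, ENNReal.ofReal (u 1 x) ∂(volume.withDensity fun z => ENNReal.ofReal (ρ 1 z))
      = ENNReal.ofReal (∫ x, u 1 x * ρ 1 x) :=
        hρ.lintegral_withDensity_ofReal (hIoc 1 h11) (huL 1 h11).continuous (hcs 1 h11) (hu0 1)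
    _ ≤ ENNReal.ofReal (∫ x, u s x * ρ s x) := ENNReal.ofReal_le_ofReal
        (integral_mul_density_le hρ hc hΓ ha hs hF hu huL hsupp hmono)
    _ = ∫⁻ y, ENNReal.ofReal (u s y) ∂(volume.withDensity fun z => ENNReal.ofReal (ρ s z)) :=
        (hρ.lintegral_withDensity_ofReal (hIoc s hs1) (huL s hs1).continuous (hcs s hs1)
          (hu0 s)).symm
    _ ≤ ∫⁻ y, ENNReal.ofReal (φ y) ∂(volume.withDensity fun z => ENNReal.ofReal (ρ s z)) := by
        refine lintegral_mono fun y => ENNReal.ofReal_le_ofReal ((min_le_left _ _).trans_eq ?_)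
        rw [hΓ.initial s (hIcc s hs1)]

/-- The points that start at time `1` with law `ρ 1` and whose trajectories stay in a ball until
time `s` have at time `s` a law that is dominated by `ρ s`. -/
theorem map_flow_restrict_le (hρ : IsClassicalDensityPath ρ w)
    (hc : ReverseContinuityEquation ρ w) (hΓ : IsFlow F a 1 M C Γ) {s R : ℝ} (ha : 0 < a)
    (hs : s ∈ Ico a 1) (hF : ∀ t ∈ Icc a 1, ∀ z, ‖z‖ ≤ R → F t z = -w t z) :
    ((volume.withDensity fun z => ENNReal.ofReal (ρ 1 z)).restrict
        {x | ∀ r ∈ Icc s 1, ‖Γ 1 x r‖ < R}).map (fun x => Γ 1 x s)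
      ≤ volume.withDensity fun z => ENNReal.ofReal (ρ s z) := by
  have hs0 : 0 < s := ha.trans_le hs.1
  have hs1 : s ∈ Icc s 1 := ⟨le_rfl, hs.2.le⟩
  have hne : (Icc s 1).Nonempty := ⟨s, hs1⟩
  have := hρ.isProbabilityMeasure (t := 1) ⟨one_pos, le_rfl⟩
  have := hρ.isProbabilityMeasure (t := s) ⟨hs0, hs.2.le⟩
  have hΓm : Measurable fun x => Γ 1 x s := (hΓ.continuous_eval 1 s).measurable
  refine Measure.le_of_forall_isClosed fun D hD => ?_
  rw [Measure.map_apply hΓm hD.measurableSet, Measure.restrict_apply (hΓm hD.measurableSet)]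
  set A := (fun x => Γ 1 x s) ⁻¹' D ∩ {x | ∀ r ∈ Icc s 1, ‖Γ 1 x r‖ < R} with hA
  have hAm : MeasurableSet A :=
    (hΓm hD.measurableSet).inter (hΓ.isOpen_setOf_norm_lt 1 s R).measurableSet
  have hδ : ∀ n : ℕ, (0 : ℝ) < 1 / ((n : ℝ) + 1) := fun n => Nat.one_div_pos_of_nat
  refine ge_of_tendsto (tendsto_lintegral_thickenedIndicator_of_isClosed
    (volume.withDensity fun z => ENNReal.ofReal (ρ s z)) hD hδ
    tendsto_one_div_add_atTop_nhds_zero_nat) (Eventually.of_forall fun n => ?_)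
  -- Two limits are taken: `m → ∞` turns the killing factor into the indicator of staying in the
  -- open ball, by Fatou, and `n → ∞` shrinks the thickened indicators to that of `D`.
  let φ : EuclideanSpace ℝ (Fin k) → ℝ := fun z => thickenedIndicator (hδ n) D z
  have hφ : LipschitzWith (Real.toNNReal (1 / ((n : ℝ) + 1)))⁻¹ φ :=
    (lipschitzWith_thickenedIndicator (hδ n) D)
  have hφe : ∀ z, ENNReal.ofReal (φ z) = thickenedIndicator (hδ n) D z := fun z =>
    ENNReal.ofReal_coe_nnreal
  let f : ℕ → EuclideanSpace ℝ (Fin k) → ℝ≥0∞ := fun m x => ENNReal.ofReal (min (φ (Γ 1 x s))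
    (sInf ((fun r => m * max 0 (R - ‖Γ 1 x (min r 1)‖)) '' Icc s 1)))
  have hfm : ∀ m, Measurable (f m) := by
    intro m
    refine ENNReal.measurable_ofReal.comp (Continuous.measurable ?_)
    refine (hφ.continuous.comp (hΓ.continuous_eval 1 s)).min ?_
    refine isCompact_Icc.continuous_sInf
      (f := fun (x : EuclideanSpace ℝ (Fin k)) r => m * max 0 (R - ‖Γ 1 x (min r 1)‖)) ?_
    have := hΓ.continuous.comp
      (by fun_prop : Continuous fun q : EuclideanSpace ℝ (Fin k) × ℝ => ((1 : ℝ), q.1, min q.2 1))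
    exact continuous_const.mul (continuous_const.max (continuous_const.sub this.norm))
  have hfA : ∀ x, A.indicator 1 x ≤ liminf (fun m => f m x) atTop := by
    intro x
    by_cases hx : x ∈ A
    · rw [indicator_of_mem hx]
      refine le_liminf_of_le (by isBoundedDefault) ?_
      obtain ⟨r₀, hr₀, hmax⟩ := isCompact_Icc.exists_isMaxOn hne
        (f := fun r => ‖Γ 1 x r‖) (hΓ.continuous.comp
          (by fun_prop : Continuous fun r : ℝ => ((1 : ℝ), x, r))).norm.continuousOn
      have hpos : 0 < R - ‖Γ 1 x r₀‖ := sub_pos.2 (hx.2 r₀ hr₀)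
      -- On the compact interval the trajectory keeps a positive distance from the sphere, so a
      -- large `m` lifts the killing term above `1`.
      obtain ⟨m₀, hm₀⟩ := exists_nat_ge (R - ‖Γ 1 x r₀‖)⁻¹
      filter_upwards [eventually_ge_atTop m₀] with m hm
      rw [Pi.one_apply, ENNReal.one_le_ofReal]
      refine le_min ?_ (le_csInf (hne.image _) ?_)
      · have : thickenedIndicator (hδ n) D (Γ 1 x s) = 1 := thickenedIndicator_one (hδ n) D hx.1
        exact (NNReal.coe_eq_one.2 this).ge
      · rintro _ ⟨r, hr, rfl⟩
        simp only
        rw [min_eq_left hr.2]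
        have h1 : ‖Γ 1 x r‖ ≤ ‖Γ 1 x r₀‖ := hmax hr
        have h2 : (R - ‖Γ 1 x r₀‖)⁻¹ ≤ m := hm₀.trans (by exact_mod_cast hm)
        calc (1 : ℝ) = (R - ‖Γ 1 x r₀‖)⁻¹ * (R - ‖Γ 1 x r₀‖) := (inv_mul_cancel₀ hpos.ne').symm
          _ ≤ m * max 0 (R - ‖Γ 1 x r‖) := by
            gcongr
            exact le_max_of_le_right (by linarith)
    · rw [indicator_of_notMem hx]
      exact zero_le
  rw [← lintegral_indicator_one hAm]
  refine (lintegral_mono hfA).trans ((lintegral_liminf_le hfm).trans ?_)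
  refine liminf_le_of_frequently_le' (Frequently.of_forall fun m => ?_)
  simp only [← hφe]
  exact lintegral_min_sInf_le hρ hc hΓ ha hs hF hφ (fun z => NNReal.coe_nonneg _) m

end Pushforward

/-! ### The law of a solution and its limit at time zero -/

section Law

open scoped NNReal

variable {k : ℕ} {ρ : ℝ → EuclideanSpace ℝ (Fin k) → ℝ}
  {w : ℝ → EuclideanSpace ℝ (Fin k) → EuclideanSpace ℝ (Fin k)}

theorem IsFlow.eq_of_hasDerivWithinAt_of_norm_le
    {F : ℝ → EuclideanSpace ℝ (Fin k) → EuclideanSpace ℝ (Fin k)} {a M R : ℝ} {C : ℝ≥0}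
    {Γ : ℝ → EuclideanSpace ℝ (Fin k) → ℝ → EuclideanSpace ℝ (Fin k)} (hΓ : IsFlow F a 1 M C Γ)
    (ha1 : a ≤ 1) (hF : ∀ t ∈ Icc a 1, ∀ z, ‖z‖ ≤ R → F t z = -w t z)
    {V : ℝ → EuclideanSpace ℝ (Fin k)}
    (hV : ∀ r ∈ Icc a 1, HasDerivWithinAt V (-(w r (V r))) (Icc a 1) r)
    (hR : ∀ r ∈ Icc a 1, ‖V r‖ ≤ R) : ∀ r ∈ Icc a 1, Γ 1 (V 1) r = V r :=
  hΓ.eq_of_hasDerivWithinAt V (fun r hr => by rw [hF r hr _ (hR r hr)]; exact hV r hr) 1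
    ⟨ha1, le_rfl⟩

theorem exists_nat_norm_lt_of_hasDerivWithinAt {V V' : ℝ → EuclideanSpace ℝ (Fin k)} {a b : ℝ}
    (hV : ∀ r ∈ Icc a b, HasDerivWithinAt V (V' r) (Icc a b) r) :
    ∃ N : ℕ, ∀ r ∈ Icc a b, ‖V r‖ < N := by
  obtain ⟨B, hB⟩ := isCompact_Icc.exists_bound_of_continuousOn
    fun r hr => (hV r hr).continuousWithinAt
  obtain ⟨N, hN⟩ := exists_nat_gt B
  exact ⟨N, fun r hr => (hB r hr).trans_lt hN⟩

theorem HasDerivWithinAt.Ioc_to_Icc {V : ℝ → EuclideanSpace ℝ (Fin k)} {a : ℝ} (ha : 0 < a)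
    (hV : ∀ t ∈ Ioc (0 : ℝ) 1, HasDerivWithinAt V (-(w t (V t))) (Ioc 0 1) t) :
    ∀ r ∈ Icc a 1, HasDerivWithinAt V (-(w r (V r))) (Icc a 1) r :=
  fun r hr => (hV r ⟨ha.trans_le hr.1, hr.2⟩).mono fun _ hx => ⟨ha.trans_le hx.1, hx.2⟩

/-- A solution of the reverse-time ODE that starts with law `ρ 1` has law `ρ t` at time `t`. -/
theorem IsReverseODESolution.map_eq_withDensity (hρ : IsClassicalDensityPath ρ w)
    (hc : ReverseContinuityEquation ρ w)
    (h1 : volume.withDensity (fun z => ENNReal.ofReal (ρ 1 z))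
      = stdGaussian (EuclideanSpace ℝ (Fin k)))
    {Ω : Type*} [MeasurableSpace Ω] {P : Measure Ω} [IsProbabilityMeasure P]
    {X : ℝ → Ω → EuclideanSpace ℝ (Fin k)} (hX : IsReverseODESolution w P X) {t : ℝ}
    (ht : t ∈ Ioc (0 : ℝ) 1) :
    P.map (X t) = volume.withDensity fun z => ENNReal.ofReal (ρ t z) := by
  rcases ht.2.eq_or_lt with rfl | ht1
  · exact hX.terminal.trans h1.symm
  have := hρ.isProbabilityMeasure ht
  have hXt := hX.aemeasurable t ht
  have hX1 := hX.aemeasurable 1 ⟨one_pos, le_rfl⟩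
  have := Measure.isProbabilityMeasure_map (μ := P) hXt
  -- Both sides have mass one, so domination is enough; the ball of radius `n` eventually contains
  -- each path on `[t, 1]`, and Fatou removes the ball.
  refine Measure.eq_of_le_of_isProbabilityMeasure (Measure.le_iff.2 fun A hA => ?_)
  choose F M C Γ hΓ hF using fun n : ℕ => hρ.exists_isFlow ht.1 ht.2 n
  let G : ℕ → Set (EuclideanSpace ℝ (Fin k)) := fun n =>
    (fun x => Γ n 1 x t) ⁻¹' A ∩ {x | ∀ r ∈ Icc t 1, ‖Γ n 1 x r‖ < n}
  have hΓm : ∀ n, Measurable fun x => Γ n 1 x t := fun n =>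
    ((hΓ n).continuous_eval 1 t).measurable
  have hG : ∀ n, MeasurableSet (G n) := fun n =>
    (hΓm n hA).inter ((hΓ n).isOpen_setOf_norm_lt 1 t n).measurableSet
  have hlim : ∀ᵐ ω ∂P, A.indicator (1 : EuclideanSpace ℝ (Fin k) → ℝ≥0∞) (X t ω)
      ≤ liminf (fun n => (G n).indicator (1 : EuclideanSpace ℝ (Fin k) → ℝ≥0∞) (X 1 ω)) atTop := by
    filter_upwards [hX.ode] with ω hω
    by_cases hA' : X t ω ∈ A
    · rw [indicator_of_mem hA']
      refine le_liminf_of_le (by isBoundedDefault) ?_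
      have hV := HasDerivWithinAt.Ioc_to_Icc (V := fun s => X s ω) ht.1 hω
      obtain ⟨N, hN⟩ := exists_nat_norm_lt_of_hasDerivWithinAt hV
      filter_upwards [eventually_ge_atTop N] with n hn
      have hNn : (N : ℝ) ≤ n := by exact_mod_cast hn
      have he := (hΓ n).eq_of_hasDerivWithinAt_of_norm_le ht.2 (hF n) hV
        fun r hr => (hN r hr).le.trans hNn
      have hmem : X 1 ω ∈ G n := by
        refine ⟨?_, fun r hr => ?_⟩
        · rw [mem_preimage, he t ⟨le_rfl, ht.2⟩]
          exact hA'
        · rw [he r hr]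
          exact (hN r hr).trans_le hNn
      rw [indicator_of_mem hmem]
      exact le_rfl
    · rw [indicator_of_notMem hA']
      exact zero_le
  have hm : ∀ {S : Set (EuclideanSpace ℝ (Fin k))}, MeasurableSet S →
      Measurable (S.indicator (1 : EuclideanSpace ℝ (Fin k) → ℝ≥0∞)) := fun hS =>
    measurable_one.indicator hS
  rw [← lintegral_indicator_one hA, lintegral_map' (hm hA).aemeasurable hXt]
  refine (lintegral_mono_ae hlim).trans ((lintegral_liminf_le' fun n =>
    (hm (hG n)).comp_aemeasurable hX1).trans ?_)
  refine liminf_le_of_frequently_le' (Frequently.of_forall fun n => ?_)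
  change ∫⁻ ω, (G n).indicator 1 (X 1 ω) ∂P ≤ _
  rw [← lintegral_map' (hm (hG n)).aemeasurable hX1, lintegral_indicator_one (hG n), hX.terminal,
    ← h1]
  have h2 := map_flow_restrict_le hρ hc (hΓ n) ht.1 ⟨le_rfl, ht1⟩ (hF n) A
  rwa [Measure.map_apply (hΓm n) hA, Measure.restrict_apply (hΓm n hA)] at h2

theorem IsReverseODESolution.continuousOn_integral {Ω : Type*} [MeasurableSpace Ω]
    {P : Measure Ω} [IsProbabilityMeasure P] {X : ℝ → Ω → EuclideanSpace ℝ (Fin k)}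
    (hX : IsReverseODESolution w P X) (φ : EuclideanSpace ℝ (Fin k) →ᵇ ℝ) :
    ContinuousOn (fun t => ∫ ω, φ (X t ω) ∂P) (Ioc 0 1) := by
  refine continuousOn_of_dominated (bound := fun _ => ‖φ‖) (fun t ht => ?_)
    (fun t _ => ae_of_all _ fun ω => φ.norm_coe_le_norm _) (integrable_const _) ?_
  · exact (φ.continuous.measurable.comp_aemeasurable (hX.aemeasurable t ht)).aestronglyMeasurable
  · filter_upwards [hX.ode] with ω hω
    exact φ.continuous.comp_continuousOn fun t ht => (hω t ht).continuousWithinAt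

theorem map_eq_of_tendsto_ae {E Ω : Type*} [TopologicalSpace E]
    [TopologicalSpace.PseudoMetrizableSpace E]
    [MeasurableSpace E] [BorelSpace E] [HasOuterApproxClosed E] [MeasurableSpace Ω]
    {P : Measure Ω} [IsProbabilityMeasure P] {X : ℝ → Ω → E} {X₀ : Ω → E} {κ : Measure E}
    [IsFiniteMeasure κ] (hX : ∀ t ∈ Ioc (0 : ℝ) 1, AEMeasurable (X t) P)
    (hφ : ∀ φ : E →ᵇ ℝ, Tendsto (fun t => ∫ ω, φ (X t ω) ∂P) (𝓝[>] 0) (𝓝 (∫ z, φ z ∂κ)))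
    (h0 : ∀ᵐ ω ∂P, Tendsto (fun t => X t ω) (𝓝[>] 0) (𝓝 (X₀ ω))) : P.map X₀ = κ := by
  have hseq : Tendsto (fun n : ℕ => 1 / ((n : ℝ) + 1)) atTop (𝓝[>] 0) :=
    tendsto_nhdsWithin_iff.2 ⟨tendsto_one_div_add_atTop_nhds_zero_nat,
      Eventually.of_forall fun n => mem_Ioi.2 Nat.one_div_pos_of_nat⟩
  have hmem : ∀ n : ℕ, 1 / ((n : ℝ) + 1) ∈ Ioc (0 : ℝ) 1 := fun n =>
    ⟨Nat.one_div_pos_of_nat, by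
      rw [div_le_one (by positivity)]
      linarith [Nat.cast_nonneg (α := ℝ) n]⟩
  -- No measurability of `X₀` is assumed; it comes from the limit along a sequence.
  have hX0 : AEMeasurable X₀ P := by
    refine aemeasurable_of_tendsto_metrizable_ae atTop (fun n : ℕ => hX _ (hmem n)) ?_
    filter_upwards [h0] with ω hω using hω.comp hseq
  have := Measure.isProbabilityMeasure_map (μ := P) hX0
  refine ext_of_forall_integral_eq_of_IsFiniteMeasure fun φ => ?_
  rw [integral_map hX0 φ.continuous.measurable.aestronglyMeasurable]
  refine tendsto_nhds_unique ?_ ((hφ φ).comp hseq)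
  refine tendsto_integral_filter_of_dominated_convergence (fun _ => ‖φ‖) ?_ ?_
    (integrable_const _) ?_
  · exact Eventually.of_forall fun n =>
      (φ.continuous.measurable.comp_aemeasurable (hX _ (hmem n))).aestronglyMeasurable
  · exact Eventually.of_forall fun n => ae_of_all _ fun ω => φ.norm_coe_le_norm _
  · filter_upwards [h0] with ω hω using (φ.continuous.tendsto _).comp (hω.comp hseq)

end Law

/-! ### Existence from finite mean path length -/

section Existence

open scoped NNReal

variable {k : ℕ} {ρ : ℝ → EuclideanSpace ℝ (Fin k) → ℝ}
  {w : ℝ → EuclideanSpace ℝ (Fin k) → EuclideanSpace ℝ (Fin k)}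

/-- The length of the trajectories, stopped when they leave a ball, has a mean of at most
`∫∫ ‖w‖ ρ`. -/
theorem exists_stopped_length_le (hρ : IsClassicalDensityPath ρ w)
    (hc : ReverseContinuityEquation ρ w)
    {F : ℝ → EuclideanSpace ℝ (Fin k) → EuclideanSpace ℝ (Fin k)} {a M R : ℝ} {C : ℝ≥0}
    {Γ : ℝ → EuclideanSpace ℝ (Fin k) → ℝ → EuclideanSpace ℝ (Fin k)} (hΓ : IsFlow F a 1 M C Γ)
    (ha : 0 < a) (hF : ∀ t ∈ Icc a 1, ∀ z, ‖z‖ ≤ R → F t z = -w t z) :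
    ∃ ℓ : EuclideanSpace ℝ (Fin k) → ℝ≥0∞, Measurable ℓ ∧
      ∫⁻ x, ℓ x ∂(volume.withDensity fun z => ENNReal.ofReal (ρ 1 z))
        ≤ ∫⁻ t in Ioc (0 : ℝ) 1, ∫⁻ z, ENNReal.ofReal (‖w t z‖ * ρ t z) ∧
      ∀ x, ∀ r₀ ∈ Ico a 1, (∀ r ∈ Ioc r₀ 1, ‖Γ 1 x r‖ < R) →
        ∫⁻ r in Ioo r₀ 1, ‖F r (Γ 1 x r)‖ₑ ≤ ℓ x := by
  have := hρ.isProbabilityMeasure (t := 1) ⟨one_pos, le_rfl⟩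
  -- Pairs of a starting point and a time down to which its trajectory stays in the ball; the
  -- maximum allows a fixed compact range for `r'`, which makes the set open.
  let S : Set (EuclideanSpace ℝ (Fin k) × ℝ) :=
    {q | ∀ r' ∈ Icc a 1, ‖Γ 1 q.1 (max q.2 r')‖ < R}
  have hS : MeasurableSet S := by
    refine (isOpen_setOf_forall_mem_lt isCompact_Icc
      (f := fun (q : EuclideanSpace ℝ (Fin k) × ℝ) r' => ‖Γ 1 q.1 (max q.2 r')‖) ?_
      R).measurableSet
    exact (hΓ.continuous.comp
      (by fun_prop : Continuous fun q : (EuclideanSpace ℝ (Fin k) × ℝ) × ℝ =>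
        ((1 : ℝ), q.1.1, max q.1.2 q.2))).norm
  have hSiff : ∀ x, ∀ r ∈ Ico a 1, (x, r) ∈ S ↔ ∀ r' ∈ Icc r 1, ‖Γ 1 x r'‖ < R := by
    intro x r hr
    refine ⟨fun h r' hr' => ?_, fun h r' hr' => h _ ⟨le_max_left _ _, max_le hr.2.le hr'.2⟩⟩
    have := h r' ⟨hr.1.trans hr'.1, hr'.2⟩
    rwa [max_eq_right hr'.1] at this
  let f : EuclideanSpace ℝ (Fin k) × ℝ → ℝ≥0∞ := S.indicator fun q => ‖F q.2 (Γ 1 q.1 q.2)‖ₑ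
  have hf : Measurable f := by
    refine Measurable.indicator ?_ hS
    have h1 : Continuous fun q : EuclideanSpace ℝ (Fin k) × ℝ => Γ 1 q.1 q.2 :=
      hΓ.continuous.comp (by fun_prop : Continuous fun q : EuclideanSpace ℝ (Fin k) × ℝ =>
        ((1 : ℝ), q.1, q.2))
    have h2 : Continuous fun q : EuclideanSpace ℝ (Fin k) × ℝ => F q.2 (Γ 1 q.1 q.2) :=
      hΓ.continuous_field.comp (continuous_snd.prodMk h1)
    exact h2.enorm.measurable
  refine ⟨fun x => ∫⁻ r in Ioo a 1, f (x, r), hf.lintegral_prod_right', ?_, ?_⟩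
  -- By Tonelli the mean length is an integral over times `r`, and at each `r` the law of the
  -- surviving points is at most `ρ r`.
  · rw [lintegral_lintegral_swap (f := fun x r => f (x, r)) hf.aemeasurable]
    refine (setLIntegral_mono' measurableSet_Ioo fun r hr => ?_).trans
      (lintegral_mono_set fun r hr => ⟨ha.trans hr.1, hr.2.le⟩)
    have hrI : r ∈ Ico a 1 := ⟨hr.1.le, hr.2⟩
    have hrO : r ∈ Ioc (0 : ℝ) 1 := ⟨ha.trans hr.1, hr.2.le⟩
    let T : Set (EuclideanSpace ℝ (Fin k)) := {x | ∀ r' ∈ Icc r 1, ‖Γ 1 x r'‖ < R}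
    have hT : MeasurableSet T := (hΓ.isOpen_setOf_norm_lt 1 r R).measurableSet
    have hfT : ∀ x, f (x, r) = T.indicator (fun x => ‖w r (Γ 1 x r)‖ₑ) x := by
      intro x
      by_cases hx : x ∈ T
      · have hx' : (x, r) ∈ S := (hSiff x r hrI).2 hx
        simp only [f]
        rw [indicator_of_mem hx, indicator_of_mem hx',
          hF r ⟨hrI.1, hrI.2.le⟩ _ (hx r ⟨le_rfl, hrI.2.le⟩).le, enorm_neg]
      · have hx' : (x, r) ∉ S := fun h => hx ((hSiff x r hrI).1 h)
        simp only [f]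
        rw [indicator_of_notMem hx, indicator_of_notMem hx']
    have hwm : Measurable fun z => ‖w r z‖ₑ := (hρ.continuous_velocity hrO).enorm.measurable
    have hρc := hρ.continuous_density hrO
    calc ∫⁻ x, f (x, r) ∂(volume.withDensity fun z => ENNReal.ofReal (ρ 1 z))
        = ∫⁻ z, ‖w r z‖ₑ ∂(((volume.withDensity fun z => ENNReal.ofReal (ρ 1 z)).restrict T).map
            fun x => Γ 1 x r) := by
          simp only [hfT]
          rw [lintegral_indicator hT, lintegral_map hwm (hΓ.continuous_eval 1 r).measurable]
      _ ≤ ∫⁻ z, ‖w r z‖ₑ ∂(volume.withDensity fun z => ENNReal.ofReal (ρ r z)) :=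
          lintegral_mono' (map_flow_restrict_le hρ hc hΓ ha hrI hF) le_rfl
      _ = ∫⁻ z, ENNReal.ofReal (‖w r z‖ * ρ r z) := by
          rw [lintegral_withDensity_eq_lintegral_mul _ (by fun_prop) hwm]
          refine lintegral_congr fun z => ?_
          rw [Pi.mul_apply, ENNReal.ofReal_mul (norm_nonneg _), ofReal_norm, mul_comm]
  · intro x r₀ hr₀ hx
    calc ∫⁻ r in Ioo r₀ 1, ‖F r (Γ 1 x r)‖ₑ = ∫⁻ r in Ioo r₀ 1, f (x, r) := by
          refine setLIntegral_congr_fun measurableSet_Ioo fun r hr => ?_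
          have : (x, r) ∈ S := (hSiff x r ⟨hr₀.1.trans hr.1.le, hr.2⟩).2 fun r' hr' =>
            hx r' ⟨hr.1.trans_le hr'.1, hr'.2⟩
          simp only [f]
          rw [indicator_of_mem this]
      _ ≤ ∫⁻ r in Ioo a 1, f (x, r) := lintegral_mono_set (Ioo_subset_Ioo_left hr₀.1)

theorem enorm_sub_le_lintegral_of_hasDerivWithinAt {V V' : ℝ → EuclideanSpace ℝ (Fin k)} {a b : ℝ}
    (hab : a ≤ b) (hV : ∀ r ∈ Icc a b, HasDerivWithinAt V (V' r) (Icc a b) r)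
    (hV' : ContinuousOn V' (Icc a b)) : ‖V b - V a‖ₑ ≤ ∫⁻ r in Ioo a b, ‖V' r‖ₑ := by
  have h1 := intervalIntegral.integral_eq_sub_of_hasDerivAt_of_le hab
    (fun r hr => (hV r hr).continuousWithinAt)
    (fun r hr => (hV r (Ioo_subset_Icc_self hr)).hasDerivAt (Icc_mem_nhds hr.1 hr.2))
    (hV'.intervalIntegrable_of_Icc hab)
  rw [← h1, intervalIntegral.integral_of_le hab, setLIntegral_congr Ioo_ae_eq_Ioc]
  exact enorm_integral_le_lintegral_enorm _

/-- If the mean path length is finite, then almost every trajectory survives until time `a`. -/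
theorem ae_exists_hasDerivWithinAt_Icc (hρ : IsClassicalDensityPath ρ w)
    (hc : ReverseContinuityEquation ρ w)
    (hfin : (∫⁻ t in Ioc (0 : ℝ) 1, ∫⁻ z, ENNReal.ofReal (‖w t z‖ * ρ t z)) < ∞) {a : ℝ}
    (ha : 0 < a) (ha1 : a < 1) :
    ∀ᵐ x ∂(volume.withDensity fun z => ENNReal.ofReal (ρ 1 z)),
      ∃ V : ℝ → EuclideanSpace ℝ (Fin k), V 1 = x ∧
        ∀ r ∈ Icc a 1, HasDerivWithinAt V (-(w r (V r))) (Icc a 1) r := by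
  set μ := volume.withDensity fun z => ENNReal.ofReal (ρ 1 z) with hμ
  set I := ∫⁻ t in Ioc (0 : ℝ) 1, ∫⁻ z, ENNReal.ofReal (‖w t z‖ * ρ t z) with hI
  choose F M C Γ hΓ hF using fun n : ℕ => hρ.exists_isFlow ha ha1.le n
  have h1I : (1 : ℝ) ∈ Icc a 1 := ⟨ha1.le, le_rfl⟩
  have hnull : ∀ N : ℕ, μ {x | ‖x‖ ≤ N ∧ ∀ n : ℕ, ∃ r ∈ Icc a 1, n ≤ ‖Γ n 1 x r‖} = 0 := by
    intro N
    set T := {x | ‖x‖ ≤ N ∧ ∀ n : ℕ, ∃ r ∈ Icc a 1, n ≤ ‖Γ n 1 x r‖} with hT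
    -- A point of norm at most `N` whose trajectory reaches norm `N + m` has travelled at least `m`,
    -- so Markov's inequality applies to the stopped length.
    have hbound : ∀ m : ℕ, m * μ T ≤ I := by
      intro m
      rcases m.eq_zero_or_pos with rfl | hm
      · simp
      obtain ⟨ℓ, hℓm, hℓI, hℓ⟩ := exists_stopped_length_le hρ hc (hΓ (N + m)) ha (hF (N + m))
      refine le_trans ?_ ((mul_meas_ge_le_lintegral hℓm m).trans hℓI)
      refine mul_le_mul_right (measure_mono fun x hx => ?_) _
      have hN1 : ((N + m : ℕ) : ℝ) = N + m := by push_cast; ring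
      have hm0 : (0 : ℝ) < m := by exact_mod_cast hm
      have hcont : Continuous fun r => ‖Γ (N + m) 1 x r‖ := ((hΓ (N + m)).continuous.comp
        (by fun_prop : Continuous fun r : ℝ => ((1 : ℝ), x, r))).norm
      have hcomp : IsCompact (Icc a 1 ∩ {r | ((N + m : ℕ) : ℝ) ≤ ‖Γ (N + m) 1 x r‖}) :=
        isCompact_Icc.inter_right (isClosed_le continuous_const hcont)
      -- Time runs backwards, so the greatest such time is the first exit from the ball.
      obtain ⟨r₀, hr₀, hmax⟩ := hcomp.exists_isGreatest (hx.2 (N + m))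
      have hinit : Γ (N + m) 1 x 1 = x := (hΓ (N + m)).initial 1 h1I x
      have hr₀1 : r₀ < 1 := by
        refine lt_of_le_of_ne hr₀.1.2 ?_
        rintro rfl
        have h2 := hr₀.2
        rw [mem_ofPred_eq, hinit, hN1] at h2
        linarith [hx.1]
      have hsub : Icc r₀ 1 ⊆ Icc a 1 := Icc_subset_Icc_left hr₀.1.1
      have hlt : ∀ r ∈ Ioc r₀ 1, ‖Γ (N + m) 1 x r‖ < ((N + m : ℕ) : ℝ) := by
        intro r hr
        by_contra! h
        exact absurd (hmax ⟨⟨hr₀.1.1.trans hr.1.le, hr.2⟩, h⟩) (not_le.2 hr.1)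
      refine le_trans ?_ (hℓ x r₀ ⟨hr₀.1.1, hr₀1⟩ hlt)
      refine le_trans ?_ (enorm_sub_le_lintegral_of_hasDerivWithinAt hr₀1.le
        (fun r hr => ((hΓ (N + m)).hasDerivWithinAt 1 h1I x r (hsub hr)).mono hsub) ?_)
      · rw [hinit, ← ofReal_norm, ← ENNReal.ofReal_natCast]
        refine ENNReal.ofReal_le_ofReal ?_
        have h2 := hr₀.2
        rw [mem_ofPred_eq, hN1] at h2
        have h3 := norm_sub_norm_le (Γ (N + m) 1 x r₀) x
        rw [norm_sub_rev] at h3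
        linarith [hx.1]
      · exact ((hΓ (N + m)).continuous_field.comp (continuous_id.prodMk
          ((hΓ (N + m)).continuous.comp
            (by fun_prop : Continuous fun r : ℝ => ((1 : ℝ), x, r))))).continuousOn
    by_contra h0
    obtain ⟨m, hm⟩ := ENNReal.exists_nat_mul_gt h0 hfin.ne
    exact absurd (hbound m) (not_le.2 hm)
  have hae : ∀ᵐ x ∂μ, ∃ n : ℕ, ∀ r ∈ Icc a 1, ‖Γ n 1 x r‖ < n := by
    rw [ae_iff]
    refine measure_mono_null (t := ⋃ N : ℕ,
      {x | ‖x‖ ≤ N ∧ ∀ n : ℕ, ∃ r ∈ Icc a 1, n ≤ ‖Γ n 1 x r‖}) ?_ (measure_iUnion_null hnull)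
    intro x hx
    rw [mem_ofPred_eq] at hx
    push Not at hx
    obtain ⟨N, hN⟩ := exists_nat_ge ‖x‖
    exact mem_iUnion.2 ⟨N, hN, hx⟩
  filter_upwards [hae] with x ⟨n, hn⟩
  refine ⟨Γ n 1 x, (hΓ n).initial 1 h1I x, fun r hr => ?_⟩
  rw [← hF n r hr _ (hn r hr).le]
  exact (hΓ n).hasDerivWithinAt 1 h1I x r hr

/-- Both solutions are bounded on the compact interval, hence both are trajectories of one cut-off
flow. -/
theorem eqOn_Icc_of_hasDerivWithinAt (hρ : IsClassicalDensityPath ρ w) {a : ℝ} (ha : 0 < a)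
    (ha1 : a ≤ 1) {V W : ℝ → EuclideanSpace ℝ (Fin k)}
    (hV : ∀ r ∈ Icc a 1, HasDerivWithinAt V (-(w r (V r))) (Icc a 1) r)
    (hW : ∀ r ∈ Icc a 1, HasDerivWithinAt W (-(w r (W r))) (Icc a 1) r) (h1 : V 1 = W 1) :
    EqOn V W (Icc a 1) := by
  obtain ⟨N, hN⟩ := exists_nat_norm_lt_of_hasDerivWithinAt hV
  obtain ⟨N', hN'⟩ := exists_nat_norm_lt_of_hasDerivWithinAt hW
  obtain ⟨F, M, C, Γ, hΓ, hF⟩ := hρ.exists_isFlow ha ha1 (max N N' : ℝ)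
  intro r hr
  rw [← hΓ.eq_of_hasDerivWithinAt_of_norm_le ha1 hF hV
      (fun r hr => (hN r hr).le.trans (le_max_left _ _)) r hr, h1,
    hΓ.eq_of_hasDerivWithinAt_of_norm_le ha1 hF hW
      (fun r hr => (hN' r hr).le.trans (le_max_right _ _)) r hr]

/-- Solutions on all `[a, 1]` with `a > 0` glue to a solution on `(0, 1]`. -/
theorem exists_hasDerivWithinAt_Ioc (hρ : IsClassicalDensityPath ρ w)
    {x : EuclideanSpace ℝ (Fin k)}
    (h : ∀ m : ℕ, ∃ V : ℝ → EuclideanSpace ℝ (Fin k), V 1 = x ∧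
      ∀ r ∈ Icc (1 / ((m : ℝ) + 2)) 1,
        HasDerivWithinAt V (-(w r (V r))) (Icc (1 / ((m : ℝ) + 2)) 1) r) :
    ∃ V : ℝ → EuclideanSpace ℝ (Fin k), V 1 = x ∧
      ∀ t ∈ Ioc (0 : ℝ) 1, HasDerivWithinAt V (-(w t (V t))) (Ioc 0 1) t := by
  choose V hV1 hV using h
  let a : ℕ → ℝ := fun m => 1 / ((m : ℝ) + 2)
  have ha : ∀ m, 0 < a m := fun m => by positivity
  have ha1 : ∀ m, a m ≤ 1 := fun m => by
    simp only [a]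
    rw [div_le_one (by positivity)]
    linarith [Nat.cast_nonneg (α := ℝ) m]
  have hanti : Antitone a := by
    intro m n hmn
    have : (m : ℝ) ≤ n := by exact_mod_cast hmn
    simp only [a]
    gcongr
  -- The inequality is strict, so near `t` within `(0, 1]` one single solution `V m` can be used.
  have hlt : ∀ t : ℝ, 0 < t → a ⌈1 / t⌉₊ < t := by
    intro t ht
    simp only [a]
    rw [div_lt_iff₀ (by positivity), mul_comm, ← div_lt_iff₀ ht]
    linarith [Nat.le_ceil (1 / t)]
  have hagree : ∀ m n, m ≤ n → EqOn (V m) (V n) (Icc (a m) 1) := by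
    intro m n hmn
    have hsub : Icc (a m) 1 ⊆ Icc (a n) 1 := Icc_subset_Icc_left (hanti hmn)
    exact eqOn_Icc_of_hasDerivWithinAt hρ (ha m) (ha1 m) (hV m)
      (fun r hr => (hV n r (hsub hr)).mono hsub) ((hV1 m).trans (hV1 n).symm)
  have heq : ∀ m, ∀ t ∈ Icc (a m) 1, V ⌈1 / t⌉₊ t = V m t := by
    intro m t ht
    rcases le_total m ⌈1 / t⌉₊ with hm | hm
    · exact (hagree _ _ hm ht).symm
    · exact hagree _ _ hm ⟨(hlt t ((ha m).trans_le ht.1)).le, ht.2⟩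
  refine ⟨fun t => V ⌈1 / t⌉₊ t, hV1 _, fun t ht => ?_⟩
  have htm := hlt t ht.1
  set m := ⌈1 / t⌉₊ with hm
  refine HasDerivWithinAt.congr_of_eventuallyEq (f := V m) ?_ ?_ rfl
  · refine (hV m t ⟨htm.le, ht.2⟩).mono_of_mem_nhdsWithin ?_
    filter_upwards [self_mem_nhdsWithin, mem_nhdsWithin_of_mem_nhds (Ioi_mem_nhds htm)]
      with r hr hr' using ⟨le_of_lt hr', hr.2⟩
  · filter_upwards [self_mem_nhdsWithin, mem_nhdsWithin_of_mem_nhds (Ioi_mem_nhds htm)]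
      with r hr hr' using heq m r ⟨le_of_lt hr', hr.2⟩

theorem exists_tendsto_of_lintegral_enorm_lt_top {V V' : ℝ → EuclideanSpace ℝ (Fin k)}
    (hV : ∀ t ∈ Ioc (0 : ℝ) 1, HasDerivWithinAt V (V' t) (Ioc 0 1) t)
    (hV' : ContinuousOn V' (Ioc 0 1)) (hfin : ∫⁻ r in Ioo (0 : ℝ) 1, ‖V' r‖ₑ < ∞) :
    ∃ z, Tendsto V (𝓝[>] 0) (𝓝 z) := by
  have hint : IntegrableOn V' (Ioc 0 1) := by
    refine ⟨hV'.aestronglyMeasurable measurableSet_Ioc, ?_⟩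
    rw [HasFiniteIntegral, ← setLIntegral_congr Ioo_ae_eq_Ioc]
    exact hfin
  have hint' : IntegrableOn V' (uIcc 0 1) := by
    rw [uIcc_of_le zero_le_one]
    rwa [integrableOn_Icc_iff_integrableOn_Ioc]
  have hprim := (intervalIntegral.continuousOn_primitive_interval_left hint') 0 left_mem_uIcc
  rw [uIcc_of_le zero_le_one] at hprim
  have hlim : Tendsto (fun x => ∫ t in x..1, V' t) (𝓝[>] 0) (𝓝 (∫ t in (0 : ℝ)..1, V' t)) := by
    rw [← nhdsWithin_Ioo_eq_nhdsGT (zero_lt_one (α := ℝ))]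
    exact hprim.mono_left (nhdsWithin_mono _ Ioo_subset_Icc_self)
  refine ⟨V 1 - ∫ t in (0 : ℝ)..1, V' t, (hlim.const_sub (V 1)).congr' ?_⟩
  filter_upwards [Ioo_mem_nhdsGT (zero_lt_one (α := ℝ))] with t ht
  have hsub : Icc t 1 ⊆ Ioc 0 1 := fun r hr => ⟨ht.1.trans_le hr.1, hr.2⟩
  rw [intervalIntegral.integral_eq_sub_of_hasDerivAt_of_le ht.2.le
    (fun r hr => ((hV r (hsub hr)).continuousWithinAt).mono hsub)
    (fun r hr => (hV r (hsub (Ioo_subset_Icc_self hr))).hasDerivAt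
      (Ioc_mem_nhds (ht.1.trans hr.1) hr.2))
    ((hV'.mono hsub).intervalIntegrable_of_Icc ht.2.le)]
  abel

theorem IsClassicalDensityPath.continuousOn_velocity_comp (hρ : IsClassicalDensityPath ρ w)
    {V : ℝ → EuclideanSpace ℝ (Fin k)} (hV : ContinuousOn V (Ioc 0 1)) :
    ContinuousOn (fun t => w t (V t)) (Ioc 0 1) :=
  hρ.velocity_continuousOn.comp (f := fun t => (t, V t)) (continuousOn_id.prodMk hV)
    fun _ ht => ⟨ht, mem_univ _⟩

/-- If the mean path length is finite, then almost every trajectory has finite length. -/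
theorem ae_lintegral_enorm_velocity_lt_top (hρ : IsClassicalDensityPath ρ w)
    (hc : ReverseContinuityEquation ρ w)
    (hfin : (∫⁻ t in Ioc (0 : ℝ) 1, ∫⁻ z, ENNReal.ofReal (‖w t z‖ * ρ t z)) < ∞) :
    ∀ᵐ x ∂(volume.withDensity fun z => ENNReal.ofReal (ρ 1 z)),
      ∀ V : ℝ → EuclideanSpace ℝ (Fin k), V 1 = x →
        (∀ t ∈ Ioc (0 : ℝ) 1, HasDerivWithinAt V (-(w t (V t))) (Ioc 0 1) t) →
          ∫⁻ r in Ioo (0 : ℝ) 1, ‖w r (V r)‖ₑ < ∞ := by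
  let a : ℕ → ℝ := fun m => 1 / ((m : ℝ) + 2)
  have ha : ∀ m, 0 < a m := fun m => by positivity
  have ha1 : ∀ m, a m < 1 := fun m => by
    simp only [a]
    rw [div_lt_one (by positivity)]
    linarith [Nat.cast_nonneg (α := ℝ) m]
  choose F M C Γ hΓ hF using fun (m n : ℕ) => hρ.exists_isFlow (ha m) (ha1 m).le n
  choose ℓ hℓm hℓI hℓ using fun (m n : ℕ) =>
    exists_stopped_length_le hρ hc (hΓ m n) (ha m) (hF m n)
  -- Lower limits replace limits, because the lengths for different cut-off fields are not known to
  -- be monotone in `n` or `m`; Fatou is applied twice.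
  let Λ : EuclideanSpace ℝ (Fin k) → ℝ≥0∞ := fun x =>
    liminf (fun m => liminf (fun n => ℓ m n x) atTop) atTop
  have hΛm : ∀ m, Measurable fun x => liminf (fun n => ℓ m n x) atTop := fun m =>
    Measurable.liminf (hℓm m)
  have hΛ : ∫⁻ x, Λ x ∂(volume.withDensity fun z => ENNReal.ofReal (ρ 1 z))
      ≤ ∫⁻ t in Ioc (0 : ℝ) 1, ∫⁻ z, ENNReal.ofReal (‖w t z‖ * ρ t z) := by
    refine (lintegral_liminf_le hΛm).trans
      (liminf_le_of_frequently_le' (Frequently.of_forall fun m => ?_))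
    exact (lintegral_liminf_le (hℓm m)).trans
      (liminf_le_of_frequently_le' (Frequently.of_forall fun n => hℓI m n))
  filter_upwards [ae_lt_top (Measurable.liminf hΛm) (hΛ.trans_lt hfin).ne] with x hx V hV1 hV
  refine lt_of_le_of_lt ?_ hx
  have hstep : ∀ m, ∫⁻ r in Ioo (a m) 1, ‖w r (V r)‖ₑ ≤ liminf (fun n => ℓ m n x) atTop := by
    intro m
    refine le_liminf_of_le (by isBoundedDefault) ?_
    have hVm := HasDerivWithinAt.Ioc_to_Icc (ha m) hV
    obtain ⟨N, hN⟩ := exists_nat_norm_lt_of_hasDerivWithinAt hVm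
    filter_upwards [eventually_ge_atTop N] with n hn
    have hNn : (N : ℝ) ≤ n := by exact_mod_cast hn
    have he := (hΓ m n).eq_of_hasDerivWithinAt_of_norm_le (ha1 m).le (hF m n) hVm
      fun r hr => (hN r hr).le.trans hNn
    rw [hV1] at he
    refine le_trans (le_of_eq ?_) (hℓ m n x (a m) ⟨le_rfl, ha1 m⟩ fun r hr => ?_)
    · refine setLIntegral_congr_fun measurableSet_Ioo fun r hr => ?_
      have hrI := Ioo_subset_Icc_self hr
      rw [he r hrI, hF m n r hrI _ ((hN r hrI).le.trans hNn), enorm_neg]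
    · rw [he r (Ioc_subset_Icc_self hr)]
      exact (hN r (Ioc_subset_Icc_self hr)).trans_le hNn
  have hanti : Antitone a := by
    intro m n hmn
    have : (m : ℝ) ≤ n := by exact_mod_cast hmn
    simp only [a]
    gcongr
  have hunion : Ioo (0 : ℝ) 1 = ⋃ m, Ioo (a m) 1 := by
    ext r
    simp only [mem_iUnion, mem_Ioo, exists_and_right]
    refine and_congr_left fun _ => ⟨fun hr => ⟨⌈1 / r⌉₊, ?_⟩, fun ⟨m, hm⟩ => (ha m).trans hm⟩
    simp only [a]
    rw [div_lt_iff₀ (by positivity), mul_comm, ← div_lt_iff₀ hr]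
    linarith [Nat.le_ceil (1 / r)]
  have hmono : Monotone fun m => Ioo (a m) 1 := fun m n hmn => Ioo_subset_Ioo_left (hanti hmn)
  rw [hunion, setLIntegral_iUnion_of_directed _ hmono.directed_le]
  refine iSup_le fun m => le_liminf_of_le (by isBoundedDefault) ?_
  filter_upwards [eventually_ge_atTop m] with n hn
  exact (lintegral_mono_set (hmono hn)).trans (hstep n)

theorem exists_isReverseODESolution (hρ : IsClassicalDensityPath ρ w)
    (hc : ReverseContinuityEquation ρ w)
    (h1 : volume.withDensity (fun z => ENNReal.ofReal (ρ 1 z))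
      = stdGaussian (EuclideanSpace ℝ (Fin k)))
    (hfin : (∫⁻ t in Ioc (0 : ℝ) 1, ∫⁻ z, ENNReal.ofReal (‖w t z‖ * ρ t z)) < ∞) :
    ∃ X : ℝ → EuclideanSpace ℝ (Fin k) → EuclideanSpace ℝ (Fin k),
      IsReverseODESolution w (stdGaussian (EuclideanSpace ℝ (Fin k))) X ∧ (∀ x, X 1 x = x) ∧
      ∀ᵐ x ∂(stdGaussian (EuclideanSpace ℝ (Fin k))),
        Tendsto (fun t => X t x) (𝓝[>] 0) (𝓝 (X 0 x)) := by
  classical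
  have hsurv : ∀ᵐ x ∂(stdGaussian (EuclideanSpace ℝ (Fin k))),
      ∃ V : ℝ → EuclideanSpace ℝ (Fin k), V 1 = x ∧
        ∀ t ∈ Ioc (0 : ℝ) 1, HasDerivWithinAt V (-(w t (V t))) (Ioc 0 1) t := by
    rw [← h1]
    have h2 : ∀ᵐ x ∂(volume.withDensity fun z => ENNReal.ofReal (ρ 1 z)), ∀ m : ℕ,
        ∃ V : ℝ → EuclideanSpace ℝ (Fin k), V 1 = x ∧ ∀ r ∈ Icc (1 / ((m : ℝ) + 2)) 1,
          HasDerivWithinAt V (-(w r (V r))) (Icc (1 / ((m : ℝ) + 2)) 1) r := by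
      refine ae_all_iff.2 fun m => ae_exists_hasDerivWithinAt_Icc hρ hc hfin (by positivity) ?_
      rw [div_lt_one (by positivity)]
      linarith [Nat.cast_nonneg (α := ℝ) m]
    filter_upwards [h2] with x hx using exists_hasDerivWithinAt_Ioc hρ hx
  have hγ : ∀ x, ∃ γ : ℝ → EuclideanSpace ℝ (Fin k), γ 1 = x ∧
      ((∃ V : ℝ → EuclideanSpace ℝ (Fin k), V 1 = x ∧
        ∀ t ∈ Ioc (0 : ℝ) 1, HasDerivWithinAt V (-(w t (V t))) (Ioc 0 1) t) →
      ∀ t ∈ Ioc (0 : ℝ) 1, HasDerivWithinAt γ (-(w t (γ t))) (Ioc 0 1) t) := by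
    intro x
    by_cases h : ∃ V : ℝ → EuclideanSpace ℝ (Fin k), V 1 = x ∧
        ∀ t ∈ Ioc (0 : ℝ) 1, HasDerivWithinAt V (-(w t (V t))) (Ioc 0 1) t
    · obtain ⟨V, hV1, hV⟩ := h
      exact ⟨V, hV1, fun _ => hV⟩
    -- On the exceptional null set a constant path keeps `X 1 x = x` valid for every `x`.
    · exact ⟨fun _ => x, rfl, fun h' => absurd h' h⟩
  choose γ hγ1 hγ using hγ
  have hode : ∀ᵐ x ∂(stdGaussian (EuclideanSpace ℝ (Fin k))),
      ∀ t ∈ Ioc (0 : ℝ) 1, HasDerivWithinAt (γ x) (-(w t (γ x t))) (Ioc 0 1) t := by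
    filter_upwards [hsurv] with x hx using hγ x hx
  let X : ℝ → EuclideanSpace ℝ (Fin k) → EuclideanSpace ℝ (Fin k) := fun t x =>
    if t = 0 then limUnder (𝓝[>] 0) (γ x) else γ x t
  have hXγ : ∀ t, 0 < t → ∀ x, X t x = γ x t := fun t ht x => if_neg ht.ne'
  refine ⟨X, ⟨fun t ht => ?_, ?_, ?_⟩, fun x => ?_, ?_⟩
  -- The solutions were chosen point by point, without measurability. At a fixed time they are
  -- almost everywhere the limit of the continuous maps of the cut-off flows.
  · choose F M C Γ hΓ hF using fun n : ℕ => hρ.exists_isFlow ht.1 ht.2 n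
    refine aemeasurable_of_tendsto_metrizable_ae atTop
      (f := fun (n : ℕ) x => Γ n 1 x t)
      (fun n => ((hΓ n).continuous_eval 1 t).measurable.aemeasurable) ?_
    filter_upwards [hode] with x hx
    have hV := HasDerivWithinAt.Ioc_to_Icc ht.1 hx
    obtain ⟨N, hN⟩ := exists_nat_norm_lt_of_hasDerivWithinAt hV
    refine tendsto_const_nhds.congr' ?_
    filter_upwards [eventually_ge_atTop N] with n hn
    have hNn : (N : ℝ) ≤ n := by exact_mod_cast hn
    have he := (hΓ n).eq_of_hasDerivWithinAt_of_norm_le ht.2 (hF n) hV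
      (fun r hr => (hN r hr).le.trans hNn) t ⟨le_rfl, ht.2⟩
    rw [hγ1] at he
    rw [hXγ t ht.1, he]
  · have : X 1 = id := funext fun x => (hXγ 1 one_pos x).trans (hγ1 x)
    rw [this, Measure.map_id]
  · filter_upwards [hode] with x hx t ht
    rw [hXγ t ht.1]
    exact (hx t ht).congr (fun s hs => hXγ s hs.1 x) (hXγ t ht.1 x)
  · exact (hXγ 1 one_pos x).trans (hγ1 x)
  · have hlen := ae_lintegral_enorm_velocity_lt_top hρ hc hfin
    rw [h1] at hlen
    filter_upwards [hode, hlen] with x hx hx'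
    have hcont : ContinuousOn (fun t => -(w t (γ x t))) (Ioc 0 1) :=
      (hρ.continuousOn_velocity_comp fun t ht => (hx t ht).continuousWithinAt).neg
    obtain ⟨z, hz⟩ := exists_tendsto_of_lintegral_enorm_lt_top hx hcont
      (by simpa only [enorm_neg] using hx' (γ x) (hγ1 x) hx)
    have h0 : X 0 x = z := (if_pos rfl).trans hz.limUnder_eq
    rw [h0]
    refine hz.congr' ?_
    filter_upwards [self_mem_nhdsWithin] with t ht using (hXγ t ht x).symm

end Existence

/-! ### Convergence to the posterior and the main theorem -/

section Main

variable {k : ℕ} {ρ : ℝ → EuclideanSpace ℝ (Fin k) → ℝ}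
  {w : ℝ → EuclideanSpace ℝ (Fin k) → EuclideanSpace ℝ (Fin k)}

theorem IsReverseODESolution.tendsto_integral (hρ : IsClassicalDensityPath ρ w)
    (hc : ReverseContinuityEquation ρ w)
    (h1 : volume.withDensity (fun z => ENNReal.ofReal (ρ 1 z))
      = stdGaussian (EuclideanSpace ℝ (Fin k)))
    {κ : ℝ → Measure (EuclideanSpace ℝ (Fin k))} {κ₀ : Measure (EuclideanSpace ℝ (Fin k))}
    (hκ : ∀ q : ℚ, (q : ℝ) ∈ Ioc (0 : ℝ) 1 →
      κ q = volume.withDensity fun z => ENNReal.ofReal (ρ q z))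
    (hlim : ∀ φ : EuclideanSpace ℝ (Fin k) →ᵇ ℝ, Tendsto (fun q : ℚ => ∫ z, φ z ∂(κ q))
      (comap (fun q : ℚ => (q : ℝ)) (𝓝[>] 0)) (𝓝 (∫ z, φ z ∂κ₀)))
    {Ω : Type*} [MeasurableSpace Ω] {P : Measure Ω} [IsProbabilityMeasure P]
    {X : ℝ → Ω → EuclideanSpace ℝ (Fin k)} (hX : IsReverseODESolution w P X)
    (φ : EuclideanSpace ℝ (Fin k) →ᵇ ℝ) :
    Tendsto (fun t => ∫ ω, φ (X t ω) ∂P) (𝓝[>] 0) (𝓝 (∫ z, φ z ∂κ₀)) := by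
  refine tendsto_nhdsGT_zero_of_tendsto_rat (hX.continuousOn_integral φ) ((hlim φ).congr' ?_)
  filter_upwards [tendsto_comap.eventually (Ioo_mem_nhdsGT (zero_lt_one (α := ℝ)))] with q hq
  have hqI : (q : ℝ) ∈ Ioc (0 : ℝ) 1 := Ioo_subset_Ioc_self hq
  rw [hκ q hqI, ← hX.map_eq_withDensity hρ hc h1 hqI,
    integral_map (hX.aemeasurable q hqI) φ.continuous.aestronglyMeasurable]

end Main

theorem proposition1 {k : ℕ} {Ω 𝒴 : Type*} [MeasurableSpace Ω] [MeasurableSpace 𝒴]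
    (P : Measure Ω) [IsProbabilityMeasure P]
    -- the latent process, continuous at time `0`, and the observation
    (Z : ℝ → Ω → EuclideanSpace ℝ (Fin k)) (Y : Ω → 𝒴)
    (hZ : ∀ t ∈ Icc (0 : ℝ) 1, Measurable (Z t)) (hY : Measurable Y)
    (hZ0 : ∀ᵐ ω ∂P, Tendsto (fun t => Z t ω) (𝓝[>] 0) (𝓝 (Z 0 ω)))
    -- the conditional densities `p_t(z | y)` and the conditional velocity field `v_t(z | y)`
    (p : ℝ → 𝒴 → EuclideanSpace ℝ (Fin k) → ℝ)
    (v : ℝ → 𝒴 → EuclideanSpace ℝ (Fin k) → EuclideanSpace ℝ (Fin k))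
    (hp : ∀ t ∈ Ioc (0 : ℝ) 1, IsConditionalDensity P (Z t) Y (p t)) :
    ∀ᵐ y ∂(P.map Y),
      IsClassicalDensityPath (fun t => p t y) (fun t => v t y) →
      ReverseContinuityEquation (fun t => p t y) (fun t => v t y) →
      volume.withDensity (fun z => ENNReal.ofReal (p 1 y z))
        = stdGaussian (EuclideanSpace ℝ (Fin k)) →
      -- every solution of the reverse-time ODE follows `p_t(· | y)` and tends to the posterior
      (∀ (Ω' : Type u) [MeasurableSpace Ω'] (P' : Measure Ω') [IsProbabilityMeasure P']
          (X : ℝ → Ω' → EuclideanSpace ℝ (Fin k)),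
        IsReverseODESolution (fun t => v t y) P' X →
          (∀ t ∈ Ioc (0 : ℝ) 1,
            P'.map (X t) = volume.withDensity (fun z => ENNReal.ofReal (p t y z))) ∧
          (∀ φ : EuclideanSpace ℝ (Fin k) →ᵇ ℝ,
            Tendsto (fun t => ∫ ω, φ (X t ω) ∂P') (𝓝[>] 0)
              (𝓝 (∫ z, φ z ∂(condDistrib (Z 0) Y P y)))) ∧
          (∀ X₀ : Ω' → EuclideanSpace ℝ (Fin k),
            (∀ᵐ ω ∂P', Tendsto (fun t => X t ω) (𝓝[>] 0) (𝓝 (X₀ ω))) →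
            P'.map X₀ = condDistrib (Z 0) Y P y)) ∧
      -- if the mean path length is finite, a solution exists from almost every starting point and
      -- its endpoint is a sample of the posterior
      ((∫⁻ t in Ioc (0 : ℝ) 1, ∫⁻ z, ENNReal.ofReal (‖v t y z‖ * p t y z)) < ∞ →
        ∃ X : ℝ → EuclideanSpace ℝ (Fin k) → EuclideanSpace ℝ (Fin k),
          IsReverseODESolution (fun t => v t y) (stdGaussian (EuclideanSpace ℝ (Fin k))) X ∧
          (∀ x, X 1 x = x) ∧
          (∀ᵐ x ∂(stdGaussian (EuclideanSpace ℝ (Fin k))),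
            Tendsto (fun t => X t x) (𝓝[>] 0) (𝓝 (X 0 x))) ∧
          (stdGaussian (EuclideanSpace ℝ (Fin k))).map (X 0) = condDistrib (Z 0) Y P y) := by
  -- The density hypothesis has its own null set at each time; only countably many of them may be
  -- united.
  have hpq : ∀ᵐ y ∂(P.map Y), ∀ q : ℚ, (q : ℝ) ∈ Ioc (0 : ℝ) 1 →
      condDistrib (Z q) Y P y = volume.withDensity fun z => ENNReal.ofReal (p q y z) := by
    refine ae_all_iff.2 fun q => ?_
    by_cases hq : (q : ℝ) ∈ Ioc (0 : ℝ) 1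
    · filter_upwards [hp q hq] with y hy _ using hy
    · exact Eventually.of_forall fun y h => absurd h hq
  filter_upwards [ae_tendsto_integral_condDistrib_rat P Z Y hZ hY hZ0, hpq] with y hlim hq hρ hc h1
  refine ⟨fun Ω' _ P' _ X hX => ?_, fun hfin => ?_⟩
  · have hX0 := hX.tendsto_integral hρ hc h1 (κ := fun t => condDistrib (Z t) Y P y) hq hlim
    exact ⟨fun t ht => hX.map_eq_withDensity hρ hc h1 ht, hX0,
      fun X₀ h0 => map_eq_of_tendsto_ae hX.aemeasurable hX0 h0⟩
  · obtain ⟨X, hX, hX1, h0⟩ := exists_isReverseODESolution hρ hc h1 hfin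
    exact ⟨X, hX, hX1, h0, map_eq_of_tendsto_ae hX.aemeasurable
      (hX.tendsto_integral hρ hc h1 (κ := fun t => condDistrib (Z t) Y P y) hq hlim) h0⟩
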